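/- Let $\mu$ be a finite nonnegative Borel measure on $\mathbb R^3$ (the nuclear charge distribution), $W(x)=|x|^{-1}$, $V=\mu*W$, let $c>0$ and $q\in\mathbb N$. Let $u_1,\dots,u_q\in H^2(\mathbb R^3;\mathbb C^2)$ be orthonormal in $L^2(\mathbb R^3;\mathbb C^2)$, put $\gamma=\sum_{n=1}^q|u_n\rangle\langle u_n|$, $\gamma(x,y)=\sum_n u_n(x)u_n(y)^*$, $\rho_\gamma=\sum_n|u_n|^2$, $W_{1,\gamma}=\rho_\gamma*W$, $(W_{2,\gamma}\psi)(x)=\int W(x-y)\gamma(x,y)\psi(y)\,dy$, and suppose that, with real $\lambda_n$, the Hartree–Fock equations $$\Big(-\tfrac12\Delta-V+W_{1,\gamma}-W_{2,\gamma}\Big)u_n=\lambda_nu_n,\qquad n=1,\dots,q,$$ hold. (A Hartree–Fock minimizer $\gamma_*^{\rm HF}$ written as $\sum_{n=1}^q|u_n^{\rm HF}\rangle\langle u_n^{\rm HF}|$ with its orthonormal eigenfunctions $u_n^{\rm HF}$ and eigenvalues $\lambda_n^{\rm HF}$ is of this kind.) Let $\pmb\sigma=(\sigma_1,\sigma_2,\sigma_3)$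 be the Pauli matrices, $\mathcal L=-i\pmb\sigma\cdot\nabla$, and $$E^{(2)}(\gamma)=-\frac1{4c^2}\sum_n\lambda_n\langle\mathcal Lu_n,\mathcal Lu_n\rangle+\frac1{4c^2}\sum_n\langle\mathcal Lu_n,(-V+W_{1,\gamma})\mathcal Lu_n\rangle-\frac1{4c^2}\sum_{m,n}\int_{\mathbb R^3}u_n^*(x)u_m(x)\,\langle\mathcal Lu_m,|x-\cdot|^{-1}\mathcal Lu_n\rangle\,dx .$$ Then all the terms below are well defined (all integrals converge absolutely) and $$4c^2E^{(2)}(\gamma)=E_{\rm mv}+E_{\rm D}+E_{\rm so},$$ where $$E_{\rm mv}=-\frac12\sum_n\langle u_n,(-\Delta)^2u_n\rangle$$ (in the sense of quadratic forms, $\langle u,(-\Delta)^2u\rangle=\|\Delta u\|^2$), $$E_{\rm D}=\frac12\sum_n\big\langle u_n,[\Delta(-V+W_{1,\gamma})]u_n\big\rangle-\frac12\sum_{m,n}\int_{\mathbb R^3}u_n^*(x)u_m(x)\,\big\langle u_m,[\Delta_yW(x-\cdot)]u_n\big\rangle\,dx,$$ $$E_{\rm so}=\sum_n\big\langle u_n,\pmb\sigma\cdot[\nabla(-V+W_{1,\gamma})\times(-i\nabla)]u_n\big\rangle-\sum_{m,n}\int_{\mathbb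 R^3}u_n^*(x)u_m(x)\,\big\langle u_m,\pmb\sigma\cdot[(\nabla_yW(x-\cdot))\times(-i\nabla)]u_n\big\rangle\,dx .$$ Here gradients of potentials are weak gradients, the distributional Laplacians $\Delta(-V+W_{1,\gamma})$ and $\Delta_yW(x-\cdot)$ are finite signed measures, and $\langle u,\nu v\rangle=\int u^*v\,d\nu$ for such a measure $\nu$, with the continuous representatives of $u,v\in H^2$. -/

import Mathlib

open MeasureTheory TemperedDistribution
open scoped SchwartzMap LineDeriv Laplacian ContDiff InnerProductSpace

noncomputable section

namespace HartreeFock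

/-! ### Spinors, Sobolev functions and weak derivatives -/

/-- Physical space `ℝ³`. -/
abbrev E3 : Type := EuclideanSpace ℝ (Fin 3)

/-- The spin space `ℂ²`. -/
abbrev C2 : Type := EuclideanSpace ℂ (Fin 2)

/-- The non-relativistic one-particle space `L²(ℝ³; ℂ²)`. -/
abbrev HL : Type := Lp C2 2 (volume : Measure E3)

/-- The `k`-th standard basis vector of `ℝ³`. -/
def e (k : Fin 3) : E3 := EuclideanSpace.single k (1 : ℝ)

/-- `u ∈ H²(ℝ³; ℂ²)`. -/
def InH2 (u : HL) : Prop := MemSobolev (2 : ℝ) 2 (u : 𝓢'(E3, C2))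

open Classical in
/-- The weak derivative `∂ₖ u ∈ L²` (the value is `0` if the distribution `∂ₖ u` is not in `L²`). -/
def weakPartial (k : Fin 3) (u : HL) : HL :=
  if h : ∃ g : HL, (g : 𝓢'(E3, C2)) = ∂_{e k} (u : 𝓢'(E3, C2)) then h.choose else 0

open Classical in
/-- The weak Laplacian `Δ u ∈ L²` (the value is `0` if the distribution `Δ u` is not in `L²`). -/
def weakLaplacian (u : HL) : HL :=
  if h : ∃ g : HL, (g : 𝓢'(E3, C2)) = Δ (u : 𝓢'(E3, C2)) then h.choose else 0

open Classical in
/-- The continuous representative of `u` (it exists for `u ∈ H²`). It is needed to integrate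
`|u|²` against measures that are singular with respect to Lebesgue measure. -/
def contRep (u : HL) : E3 → C2 :=
  if h : ∃ f : E3 → C2, Continuous f ∧ f =ᵐ[volume] u then h.choose else u

/-- The Pauli matrices `σ₁, σ₂, σ₃`. -/
def pauli : Fin 3 → Matrix (Fin 2) (Fin 2) ℂ :=
  ![!![0, 1; 1, 0], !![0, -Complex.I; Complex.I, 0], !![1, 0; 0, -1]]

/-- The Pauli matrices as operators on `ℂ²`. -/
def sigma (k : Fin 3) : C2 →L[ℂ] C2 := Matrix.toEuclideanCLM (𝕜 := ℂ) (pauli k)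

/-- `ℒ u = -i σ·∇ u`. -/
def diracL (u : HL) : HL := -Complex.I • ∑ k, (sigma k).compLp (weakPartial k u)

/-! ### The potentials and the Hartree–Fock equations -/

/-- The Coulomb potential `W(x) = 1 / |x|`. -/
def coulomb (x : E3) : ℝ := ‖x‖⁻¹

/-- The attractive potential `V = μ * 1/|x|` of a nuclear charge distribution `μ`. -/
def nuclearV (μ : Measure E3) (x : E3) : ℝ := ∫ y, coulomb (x - y) ∂μ

/-- The kernel `γ(x, y) = ∑ₙ uₙ(x) ⊗ uₙ(y)^*` of `γ = ∑ₙ |uₙ⟩⟨uₙ|`, acting on `v ∈ ℂ²`. -/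
def gammaKernel {q : ℕ} (u : Fin q → HL) (x y : E3) (v : C2) : C2 :=
  ∑ n, inner ℂ (u n y) v • u n x

/-- The one-particle density `ρ_γ(x) = ∑ₙ |uₙ(x)|²`. -/
def density {q : ℕ} (u : Fin q → HL) (x : E3) : ℝ := ∑ n, ‖u n x‖ ^ 2

/-- The direct term `W_{1,γ} = ρ_γ * W`. -/
def directW {q : ℕ} (u : Fin q → HL) (x : E3) : ℝ := ∫ y, density u y * coulomb (x - y)

/-- The exchange operator `(W_{2,γ} ψ)(x) = ∫ W(x-y) γ(x,y) ψ(y) dy`. -/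
def exchangeW {q : ℕ} (u : Fin q → HL) (ψ : HL) (x : E3) : C2 :=
  ∫ y, (coulomb (x - y) : ℂ) • gammaKernel u x y (ψ y)

/-- The multiplicative potential `-V + W_{1,γ}`. -/
def meanField (μ : Measure E3) {q : ℕ} (u : Fin q → HL) (x : E3) : ℝ :=
  -nuclearV μ x + directW u x

/-- `u₁, …, u_q` is an orthonormal family of eigenfunctions of the Hartree–Fock operator
`H_{0,γ} = -Δ/2 - V + W_{1,γ} - W_{2,γ}` with domain `H²(ℝ³; ℂ²)`, where `γ = ∑ₙ |uₙ⟩⟨uₙ|`,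
with eigenvalues `ε₁, …, ε_q`. -/
structure IsHFState (μ : Measure E3) {q : ℕ} (u : Fin q → HL) (ε : Fin q → ℝ) : Prop where
  orthonormal : Orthonormal ℂ u
  mem_domain : ∀ n, InH2 (u n)
  eigen : ∀ n, ∀ᵐ x : E3, -(1 / 2 : ℂ) • weakLaplacian (u n) x
    + (meanField μ u x : ℂ) • u n x - exchangeW u (u n) x = (ε n : ℂ) • u n x

/-! ### Distributional gradient and Laplacian of a potential -/

/-- `G` is the weak gradient of `Φ`. -/
def IsWeakGradient (Φ : E3 → ℝ) (G : E3 → E3) : Prop :=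
  LocallyIntegrable Φ ∧ LocallyIntegrable G ∧
    ∀ φ : E3 → ℝ, ContDiff ℝ ∞ φ → HasCompactSupport φ → ∀ k : Fin 3,
      ∫ x, Φ x * fderiv ℝ φ x (e k) = -∫ x, G x k * φ x

open Classical in
/-- The weak gradient `∇Φ` (unique almost everywhere when it exists). -/
def weakGrad (Φ : E3 → ℝ) : E3 → E3 :=
  if h : ∃ G, IsWeakGradient Φ G then h.choose else 0

/-- Integrability with respect to a signed measure. -/
def SignedIntegrable (ν : SignedMeasure E3) (f : E3 → ℂ) : Prop :=
  Integrable f ν.toJordanDecomposition.posPart ∧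
    Integrable f ν.toJordanDecomposition.negPart

/-- The integral `∫ f dν` with respect to a signed measure. -/
def signedIntegral (ν : SignedMeasure E3) (f : E3 → ℂ) : ℂ :=
  (∫ x, f x ∂ν.toJordanDecomposition.posPart) - ∫ x, f x ∂ν.toJordanDecomposition.negPart

/-- The distributional Laplacian of `Φ` is the signed measure `ν`. -/
def IsDistribLaplacian (Φ : E3 → ℝ) (ν : SignedMeasure E3) : Prop :=
  LocallyIntegrable Φ ∧
    ∀ φ : E3 → ℝ, ContDiff ℝ ∞ φ → HasCompactSupport φ →
      ((∫ x, Φ x * (Δ φ) x : ℝ) : ℂ) = signedIntegral ν (fun x => (φ x : ℂ))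

open Classical in
/-- The distributional Laplacian `ΔΦ` as a (unique, when it exists) signed measure. -/
def distribLaplacian (Φ : E3 → ℝ) : SignedMeasure E3 :=
  if h : ∃ ν, IsDistribLaplacian Φ ν then h.choose else 0

/-- `(σ·[G × (-i∇)] u)(x)` for a vector field `G`; indices `k+1`, `k+2` are taken modulo `3`, so
that `(a × b)ₖ = a_{k+1} b_{k+2} - a_{k+2} b_{k+1}`. -/
def spinOrbitOp (G : E3 → E3) (u : HL) (x : E3) : C2 :=
  ∑ k : Fin 3, sigma k (-Complex.I •
    ((G x (k + 1) : ℂ) • weakPartial (k + 2) u x - (G x (k + 2) : ℂ) • weakPartial (k + 1) u x))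

/-! ### The leading relativistic correction and its three parts -/

/-- The leading order relativistic correction `E^{(2)}(γ)` for `γ = ∑ₙ |uₙ⟩⟨uₙ|`. -/
def E2 (c : ℝ) (μ : Measure E3) {q : ℕ} (u : Fin q → HL) (ε : Fin q → ℝ) : ℂ :=
  -(1 / (4 * (c : ℂ) ^ 2)) * (∑ n, (ε n : ℂ) * inner ℂ (diracL (u n)) (diracL (u n)))
  + (1 / (4 * (c : ℂ) ^ 2)) *
      (∑ n, (∫ x, inner ℂ (diracL (u n) x) ((meanField μ u x : ℂ) • diracL (u n) x)))
  - (1 / (4 * (c : ℂ) ^ 2)) *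
      (∑ m, ∑ n, (∫ x, inner ℂ (u n x) (u m x) *
        (∫ y, inner ℂ (diracL (u m) y) ((coulomb (x - y) : ℂ) • diracL (u n) y))))

/-- The mass-velocity term `-½ ∑ₙ ⟨uₙ, (-Δ)² uₙ⟩`, where `⟨u, (-Δ)² u⟩ = ⟨-Δu, -Δu⟩` is the
quadratic form of `(-Δ)²`, with form domain `H²`. -/
def Emv {q : ℕ} (u : Fin q → HL) : ℂ :=
  -(1 / 2 : ℂ) * (∑ n, inner ℂ (-weakLaplacian (u n)) (-weakLaplacian (u n)))

/-- The Darwin term. -/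
def ED (μ : Measure E3) {q : ℕ} (u : Fin q → HL) : ℂ :=
  (1 / 2 : ℂ) * (∑ n, signedIntegral (distribLaplacian (meanField μ u))
      (fun x => inner ℂ (contRep (u n) x) (contRep (u n) x)))
  - (1 / 2 : ℂ) * (∑ m, ∑ n, (∫ x, inner ℂ (u n x) (u m x) *
      signedIntegral (distribLaplacian (fun y => coulomb (x - y)))
        (fun y => inner ℂ (contRep (u m) y) (contRep (u n) y))))

/-- The spin-orbit term. -/
def Eso (μ : Measure E3) {q : ℕ} (u : Fin q → HL) : ℂ :=
  (∑ n, (∫ x, inner ℂ (u n x) (spinOrbitOp (weakGrad (meanField μ u)) (u n) x)))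
  - (∑ m, ∑ n, (∫ x, inner ℂ (u n x) (u m x) *
      (∫ y, inner ℂ (u m y) (spinOrbitOp (weakGrad (fun y => coulomb (x - y))) (u n) y))))

/-- Every derivative, representative and integral that enters `E2`, `Emv`, `ED` and `Eso` exists, so
that none of them takes a default value. -/
structure WellDefined (μ : Measure E3) {q : ℕ} (u : Fin q → HL) : Prop where
  weakPartial_eq : ∀ n k,
    (weakPartial k (u n) : 𝓢'(E3, C2)) = ∂_{e k} (u n : 𝓢'(E3, C2))
  weakLaplacian_eq : ∀ n, (weakLaplacian (u n) : 𝓢'(E3, C2)) = Δ (u n : 𝓢'(E3, C2))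
  contRep_spec : ∀ n, Continuous (contRep (u n)) ∧ contRep (u n) =ᵐ[volume] u n
  laplacian_meanField : IsDistribLaplacian (meanField μ u) (distribLaplacian (meanField μ u))
  laplacian_coulomb : ∀ x : E3, IsDistribLaplacian (fun y => coulomb (x - y))
    (distribLaplacian (fun y => coulomb (x - y)))
  gradient_meanField : IsWeakGradient (meanField μ u) (weakGrad (meanField μ u))
  gradient_coulomb : ∀ x : E3, IsWeakGradient (fun y => coulomb (x - y))
    (weakGrad (fun y => coulomb (x - y)))
  integrable_direct : ∀ n, Integrable
    (fun x => inner ℂ (diracL (u n) x) ((meanField μ u x : ℂ) • diracL (u n) x))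
  integrable_exchange_inner : ∀ m n, ∀ x : E3, Integrable
    (fun y => inner ℂ (diracL (u m) y) ((coulomb (x - y) : ℂ) • diracL (u n) y))
  integrable_exchange : ∀ m n, Integrable (fun x => inner ℂ (u n x) (u m x) *
    ∫ y, inner ℂ (diracL (u m) y) ((coulomb (x - y) : ℂ) • diracL (u n) y))
  integrable_darwin : ∀ n, SignedIntegrable (distribLaplacian (meanField μ u))
    (fun x => inner ℂ (contRep (u n) x) (contRep (u n) x))
  integrable_darwin_exchange_inner : ∀ m n, ∀ x : E3,
    SignedIntegrable (distribLaplacian (fun y => coulomb (x - y)))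
      (fun y => inner ℂ (contRep (u m) y) (contRep (u n) y))
  integrable_darwin_exchange : ∀ m n, Integrable (fun x => inner ℂ (u n x) (u m x) *
    signedIntegral (distribLaplacian (fun y => coulomb (x - y)))
      (fun y => inner ℂ (contRep (u m) y) (contRep (u n) y)))
  integrable_spinOrbit : ∀ n, Integrable
    (fun x => inner ℂ (u n x) (spinOrbitOp (weakGrad (meanField μ u)) (u n) x))
  integrable_spinOrbit_exchange_inner : ∀ m n, ∀ x : E3, Integrable
    (fun y => inner ℂ (u m y) (spinOrbitOp (weakGrad (fun y => coulomb (x - y))) (u n) y))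
  integrable_spinOrbit_exchange : ∀ m n, Integrable (fun x => inner ℂ (u n x) (u m x) *
    ∫ y, inner ℂ (u m y) (spinOrbitOp (weakGrad (fun y => coulomb (x - y))) (u n) y))

end HartreeFock

end

/-!
Everything reduces to identities for a single Coulomb centre `a`, that is, for the kernel
`|x - a|⁻¹`. Integrating by parts and expanding `(σ·∇)(σ·∇)` by the Clifford relations turns
`⟨ℒu, |x - a|⁻¹ ℒv⟩` into `-⟨u, |x - a|⁻¹ Δv⟩ - ⟨u, ∇|x - a|⁻¹ · ∇v⟩` plus the spin-orbit form at
`a`; the integrations by parts are done for `(|x - a|² + δ²)^(-1/2)`, and Hardy's inequality lets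
`δ → 0`, uniformly in `a`. Averaging over the nuclear and electronic charges gives the same identity
for the mean-field and exchange potentials.

The Hartree–Fock equations, tested against `Δuₙ`, absorb the terms `-⟨u, |x - a|⁻¹ Δv⟩` together
with the eigenvalues into the mass-velocity term. They also show that the average of these terms is
real, hence so is that of the gradient terms, which therefore equals half its sum with its
conjugate. Since `-Δ|x - a|⁻¹` is a multiple of the point mass at `a`, that half is minus the
Darwin term.
-/

noncomputable section

namespace HartreeFock

open Filter Topology FourierTransform ComplexConjugate

/-! ### Sobolev functions and their Schwartz approximations -/

theorem norm_one_add_norm_sq_rpow_le_one {E : Type*} [NormedAddCommGroup E] (x : E) :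
    ‖(((1 + ‖x‖ ^ 2) ^ (-1 / 2 : ℝ) : ℝ) : ℂ)‖ ≤ 1 := by
  rw [Complex.norm_real, Real.norm_of_nonneg (by positivity)]
  exact Real.rpow_le_one_of_one_le_of_nonpos (by nlinarith [sq_nonneg ‖x‖]) (by norm_num)

theorem norm_mul_one_add_norm_sq_rpow_le_one {E : Type*} [NormedAddCommGroup E] (x : E) :
    ‖x‖ * (1 + ‖x‖ ^ 2) ^ (-1 / 2 : ℝ) ≤ 1 := by
  rw [neg_div, Real.rpow_neg (by positivity), ← Real.sqrt_eq_rpow, ← div_eq_mul_inv]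
  exact div_le_one_of_le₀ (Real.le_sqrt_of_sq_le (by linarith)) (Real.sqrt_nonneg _)

theorem norm_one_add_norm_sq_rpow_mul_inner_le {E : Type*} [NormedAddCommGroup E]
    [InnerProductSpace ℝ E] (m x : E) :
    ‖(2 * Real.pi * Complex.I) *
      ((((1 + ‖x‖ ^ 2) ^ (-1 / 2 : ℝ) : ℝ) : ℂ) * (inner ℝ x m : ℝ))‖ ≤ 2 * Real.pi * ‖m‖ := by
  simp only [norm_mul, Complex.norm_real, Complex.norm_I, Complex.norm_ofNat, mul_one,
    Real.norm_eq_abs, abs_of_pos Real.pi_pos]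
  rw [abs_of_nonneg (by positivity)]
  gcongr
  calc (1 + ‖x‖ ^ 2) ^ (-1 / 2 : ℝ) * |inner ℝ x m|
      ≤ (1 + ‖x‖ ^ 2) ^ (-1 / 2 : ℝ) * (‖x‖ * ‖m‖) := by
        gcongr; exact abs_real_inner_le_norm x m
    _ = ‖x‖ * (1 + ‖x‖ ^ 2) ^ (-1 / 2 : ℝ) * ‖m‖ := by ring
    _ ≤ ‖m‖ := mul_le_of_le_one_left (norm_nonneg m) (norm_mul_one_add_norm_sq_rpow_le_one x)

theorem exists_clm_eq_lpSMul {α F : Type*} [MeasurableSpace α] {μ : Measure α}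
    [NormedAddCommGroup F] [NormedSpace ℂ F] {p : ENNReal} [Fact (1 ≤ p)] (g : Lp ℂ ⊤ μ) :
    ∃ T : Lp F p μ →L[ℂ] Lp F p μ, ∀ f, T f = g • f :=
  ⟨LinearMap.mkContinuous
    { toFun := fun f => (g • f : Lp F p μ)
      map_add' := fun _ _ => Lp.add_smul _ _ _
      map_smul' := fun c f => (Lp.smul_comm c g f).symm }
    ‖g‖ fun _ => Lp.norm_smul_le _ _, fun _ => rfl⟩

section Sobolev

variable {E F : Type*} [NormedAddCommGroup E] [InnerProductSpace ℝ E] [FiniteDimensional ℝ E]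
  [MeasurableSpace E] [BorelSpace E] [NormedAddCommGroup F] [InnerProductSpace ℂ F]

theorem lineDerivOp_fourierMultiplierCLM {b : E → ℂ} (hb : b.HasTemperateGrowth) (m : E)
    (f : 𝓢'(E, F)) :
    ∂_{m} (TemperedDistribution.fourierMultiplierCLM F b f) =
      TemperedDistribution.fourierMultiplierCLM F
        (fun x => (2 * Real.pi * Complex.I) * (b x * (inner ℝ x m : ℝ))) f := by
  have hi : (fun x : E => ((inner ℝ x m : ℝ) : ℂ)).HasTemperateGrowth := by fun_prop
  have hmul : (fun x => (2 * Real.pi * Complex.I) * (b x * (inner ℝ x m : ℝ))) =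
      (2 * Real.pi * Complex.I) • (b * fun x : E => ((inner ℝ x m : ℝ) : ℂ)) := rfl
  rw [TemperedDistribution.lineDeriv_eq_fourierMultiplierCLM,
    TemperedDistribution.fourierMultiplierCLM_fourierMultiplierCLM_apply hb hi, hmul,
    TemperedDistribution.fourierMultiplierCLM_smul (hb.mul hi)]
  rfl

variable [CompleteSpace F]

theorem eq_of_toTemperedDistribution_eq {p : ENNReal} [Fact (1 ≤ p)]
    {f g : Lp F p (volume : Measure E)} (h : (f : 𝓢'(E, F)) = g) : f = g :=
  LinearMap.ker_eq_bot.1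
    (Lp.ker_toTemperedDistributionCLM_eq_bot (E := E) (F := F) (μ := volume) (p := p)) h

theorem exists_clm_toTemperedDistribution_eq_smulLeftCLM {g : E → ℂ} (hg : g.HasTemperateGrowth)
    {C : ℝ} (hC : ∀ x, ‖g x‖ ≤ C) :
    ∃ T : Lp F 2 (volume : Measure E) →L[ℂ] Lp F 2 (volume : Measure E),
      ∀ f, (T f : 𝓢'(E, F)) = smulLeftCLM F g f := by
  have hmem : MemLp g ⊤ (volume : Measure E) :=
    memLp_top_of_bound hg.1.continuous.aestronglyMeasurable C (ae_of_all _ hC)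
  obtain ⟨T, hT⟩ := exists_clm_eq_lpSMul (F := F) (p := 2) (hmem.toLp g)
  exact ⟨T, fun f => by rw [hT, Lp.toTemperedDistribution_smul_eq hg hmem f]⟩

theorem exists_clm_toTemperedDistribution_eq_fourierMultiplierCLM {g : E → ℂ}
    (hg : g.HasTemperateGrowth) {C : ℝ} (hC : ∀ x, ‖g x‖ ≤ C) :
    ∃ T : Lp F 2 (volume : Measure E) →L[ℂ] Lp F 2 (volume : Measure E),
      ∀ f, (T f : 𝓢'(E, F)) = TemperedDistribution.fourierMultiplierCLM F g f := by
  obtain ⟨T, hT⟩ := exists_clm_toTemperedDistribution_eq_smulLeftCLM (F := F) hg hC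
  refine ⟨fourierInvCLM ℂ (Lp F 2 (volume : Measure E)) ∘L T ∘L
    fourierCLM ℂ (Lp F 2 (volume : Measure E)), fun f => ?_⟩
  simp only [ContinuousLinearMap.comp_apply, fourierInvCLM_apply, fourierCLM_apply]
  rw [← Lp.fourierInv_toTemperedDistribution_eq, hT, ← Lp.fourier_toTemperedDistribution_eq,
    TemperedDistribution.fourierMultiplierCLM_apply]

/-- `u ∈ L²` has the strong derivative `g ∈ L²` in the direction `m`: there are Schwartz functions
`φⱼ → u` with `∂ₘ φⱼ → g`, both limits being in `L²`. -/
def HasL2Deriv (m : E) (u g : Lp F 2 (volume : Measure E)) : Prop :=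
  ∃ φ : ℕ → 𝓢(E, F), Tendsto (fun j => (φ j).toLp 2) atTop (𝓝 u) ∧
    Tendsto (fun j => (∂_{m} (φ j)).toLp 2) atTop (𝓝 g)

theorem hasL2Deriv_of_memSobolev_one {m : E} {u g : Lp F 2 (volume : Measure E)}
    (hu : MemSobolev 1 2 (u : 𝓢'(E, F))) (hg : (g : 𝓢'(E, F)) = ∂_{m} (u : 𝓢'(E, F))) :
    HasL2Deriv m u g := by
  let b : E → ℂ := fun x => (((1 + ‖x‖ ^ 2) ^ (-1 / 2 : ℝ) : ℝ) : ℂ)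
  have hb : b.HasTemperateGrowth := by unfold b; fun_prop
  obtain ⟨f, hf⟩ := hu
  replace hf : TemperedDistribution.fourierMultiplierCLM F b f = u :=
    (besselPotential_neg_apply_eq_iff 1 _ _).2 hf
  obtain ⟨T, hT⟩ := exists_clm_toTemperedDistribution_eq_fourierMultiplierCLM (F := F) hb
    norm_one_add_norm_sq_rpow_le_one
  obtain ⟨S, hS⟩ := exists_clm_toTemperedDistribution_eq_fourierMultiplierCLM (F := F)
    (by fun_prop) (norm_one_add_norm_sq_rpow_mul_inner_le m)
  have hTf : T f = u := eq_of_toTemperedDistribution_eq ((hT f).trans hf)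
  have hSf : S f = g := eq_of_toTemperedDistribution_eq <| by
    rw [hS, hg, ← hf, lineDerivOp_fourierMultiplierCLM hb]
  obtain ⟨v, hv, hvf⟩ := mem_closure_iff_seq_limit.1
    (SchwartzMap.denseRange_toLpCLM (F := F) (E := E) (p := 2) (μ := volume) (by simp) f)
  choose ψ hψ using hv
  have hTψ (j : ℕ) : (SchwartzMap.fourierMultiplierCLM F b (ψ j)).toLp 2 = T (v j) :=
    eq_of_toTemperedDistribution_eq <| by
      rw [hT, ← hψ]
      simp [Lp.toTemperedDistribution_toLp_eq,
        TemperedDistribution.fourierMultiplierCLM_toTemperedDistributionCLM_eq hb]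
  have hSψ (j : ℕ) : (∂_{m} (SchwartzMap.fourierMultiplierCLM F b (ψ j))).toLp 2 = S (v j) :=
    eq_of_toTemperedDistribution_eq <| by
      rw [hS, ← hψ, ← lineDerivOp_fourierMultiplierCLM hb]
      simp [Lp.toTemperedDistribution_toLp_eq, lineDerivOp_toTemperedDistributionCLM_eq,
        TemperedDistribution.fourierMultiplierCLM_toTemperedDistributionCLM_eq hb]
  refine ⟨fun j => SchwartzMap.fourierMultiplierCLM F b (ψ j), ?_, ?_⟩
  · simpa only [hTψ, hTf, Function.comp_def] using (T.continuous.tendsto f).comp hvf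
  · simpa only [hSψ, hSf, Function.comp_def] using (S.continuous.tendsto f).comp hvf

end Sobolev

section ContinuousRepresentative

open scoped BoundedContinuousFunction

variable {E F : Type*} [NormedAddCommGroup E] [InnerProductSpace ℝ E] [FiniteDimensional ℝ E]
  [MeasurableSpace E] [BorelSpace E] [NormedAddCommGroup F]

section

variable [NormedSpace ℂ F]

theorem exists_boundedContinuous_eq_fourierInv {v : E → F} (hv : Integrable v) :
    ∃ f : E →ᵇ F, ⇑f = 𝓕⁻ v := by
  have hc : Continuous (𝓕⁻ v) := VectorFourier.fourierIntegral_continuous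
    Real.continuous_fourierChar continuous_inner.neg hv
  exact ⟨.ofNormedAddCommGroup (𝓕⁻ v) hc (∫ x, ‖v x‖) fun x =>
    VectorFourier.norm_fourierIntegral_le_integral_norm _ _ _ _ _, rfl⟩

theorem integral_fourierInv_smul_eq [CompleteSpace F] {g : E → ℂ} {v : E → F} (hg : Integrable g)
    (hv : Integrable v) : ∫ x, 𝓕⁻ g x • v x = ∫ x, g x • 𝓕⁻ v x := by
  have h := VectorFourier.integral_fourierIntegral_smul_eq_flip (L := -innerₗ E)
    (μ := volume) (ν := volume) Real.continuous_fourierChar continuous_inner.neg hg hv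
  have hflip : (-innerₗ E).flip = -innerₗ E := by ext; simp [real_inner_comm]
  rwa [hflip] at h

end

variable [InnerProductSpace ℂ F] [CompleteSpace F]

/- By the Sobolev embedding theorem in Fourier space, the Fourier transform of `u` is integrable. -/
theorem exists_boundedContinuous_ae_eq_of_memSobolev {s : ℝ} (hs : Module.finrank ℝ E < 2 * s)
    {u : Lp F 2 (volume : Measure E)} (hu : MemSobolev s 2 (u : 𝓢'(E, F))) :
    ∃ f : E →ᵇ F, f =ᵐ[volume] u := by
  obtain ⟨v, hv⟩ := hu.fourier_memL1 hs
  have hvi : Integrable v := L1.integrable_coeFn v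
  obtain ⟨f, hf⟩ := exists_boundedContinuous_eq_fourierInv hvi
  have hui : LocallyIntegrable u :=
    (Lp.memLp u).locallyIntegrable (by norm_num)
  refine ⟨f, ae_eq_of_integral_contDiff_smul_eq f.continuous.locallyIntegrable hui
    fun φ hφ hφc => ?_⟩
  let ψ : 𝓢(E, ℂ) := (hφc.comp_left (g := fun r : ℝ => (r : ℂ)) (by simp)).toSchwartzMap
    (Complex.ofRealCLM.contDiff.comp hφ)
  have key : (u : 𝓢'(E, F)) ψ = ∫ x, ψ x • f x := by
    rw [hf, ← integral_fourierInv_smul_eq ψ.integrable hvi,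
      ← fourierInv_fourier_eq (F := 𝓢'(E, F)) (u : 𝓢'(E, F)),
      TemperedDistribution.fourierInv_apply, hv, Lp.toTemperedDistribution_apply,
      SchwartzMap.fourierInv_coe]
  have hψ (x : E) : ψ x = (φ x : ℂ) := rfl
  simpa only [Lp.toTemperedDistribution_apply, hψ, Complex.coe_smul] using key.symm

end ContinuousRepresentative

/-! ### Weak differentiability of scalar products -/

theorem bounded_mul {α : Type*} {f g : α → ℝ} (hf : ∃ C, ∀ x, |f x| ≤ C)
    (hg : ∃ C, ∀ x, |g x| ≤ C) : ∃ C, ∀ x, |f x * g x| ≤ C := by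
  obtain ⟨C, hC⟩ := hf
  obtain ⟨D, hD⟩ := hg
  exact ⟨C * D, fun x => (abs_mul _ _).trans_le
    (mul_le_mul (hC x) (hD x) (abs_nonneg _) ((abs_nonneg _).trans (hC x)))⟩

theorem bounded_add {α : Type*} {f g : α → ℝ} (hf : ∃ C, ∀ x, |f x| ≤ C)
    (hg : ∃ C, ∀ x, |g x| ≤ C) : ∃ C, ∀ x, |f x + g x| ≤ C := by
  obtain ⟨C, hC⟩ := hf
  obtain ⟨D, hD⟩ := hg
  exact ⟨C + D, fun x => (abs_add_le _ _).trans (add_le_add (hC x) (hD x))⟩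

theorem memLp_top_ofReal {α : Type*} [TopologicalSpace α] [MeasurableSpace α]
    [OpensMeasurableSpace α] {μ : Measure α} {ψ : α → ℝ} (hψ : Continuous ψ)
    (hb : ∃ C, ∀ x, |ψ x| ≤ C) : MemLp (fun x => (ψ x : ℂ)) ⊤ μ := by
  obtain ⟨C, hC⟩ := hb
  exact memLp_top_of_bound (by fun_prop) C (ae_of_all _ (by simpa using hC))

theorem integrable_ofReal_mul {α : Type*} [TopologicalSpace α] [MeasurableSpace α]
    [OpensMeasurableSpace α] {μ : Measure α} {ψ : α → ℝ} (hψ : Continuous ψ)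
    (hb : ∃ C, ∀ x, |ψ x| ≤ C) {f : α → ℂ} (hf : Integrable f μ) :
    Integrable (fun x => (ψ x : ℂ) * f x) μ :=
  hf.mul_of_top_right (memLp_top_ofReal hψ hb)

theorem integrable_inner_clm {α F : Type*} [MeasurableSpace α] {μ : Measure α}
    [NormedAddCommGroup F] [InnerProductSpace ℂ F] (M : F →L[ℂ] F) (f g : Lp F 2 μ) :
    Integrable (fun x => inner ℂ (f x) (M (g x))) μ := by
  refine (L2.integrable_inner (𝕜 := ℂ) f (M.compLp g)).congr ?_
  filter_upwards [M.coeFn_compLp g] with x hx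
  rw [hx]

theorem exists_clm_integral_mul_inner_clm {α F : Type*} [TopologicalSpace α] [MeasurableSpace α]
    [OpensMeasurableSpace α] {μ : Measure α} [NormedAddCommGroup F] [InnerProductSpace ℂ F]
    {ψ : α → ℝ} (hψ : Continuous ψ) (hb : ∃ C, ∀ x, |ψ x| ≤ C) (M : F →L[ℂ] F) :
    ∃ T : Lp F 2 μ →L[ℂ] Lp F 2 μ, ∀ f g : Lp F 2 μ,
      ∫ x, (ψ x : ℂ) * inner ℂ (f x) (M (g x)) ∂μ = inner ℂ f (T g) := by
  have hmem := memLp_top_ofReal (μ := μ) hψ hb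
  obtain ⟨T, hT⟩ := exists_clm_eq_lpSMul (F := F) (p := 2) (hmem.toLp _)
  refine ⟨T ∘L M.compLpL 2 μ, fun f g => ?_⟩
  rw [L2.inner_def]
  refine integral_congr_ae ?_
  filter_upwards [M.coeFn_compLpL (p := 2) (μ := μ) g, hmem.coeFn_toLp,
    Lp.coeFn_lpSMul (r := 2) (hmem.toLp _) (M.compLpL 2 μ g)] with x hM hψx hx
  rw [ContinuousLinearMap.comp_apply, hT, hx, Pi.smul_apply', hψx, hM, inner_smul_right]

section WeakDerivative

variable {E F : Type*} [NormedAddCommGroup E] [InnerProductSpace ℝ E]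

/-- `ψ` is an admissible test function for weak derivatives in the direction `m`: it is bounded and
continuous, with the bounded continuous derivative `ψ'`. Decay is not required, so that the
regularised Coulomb kernels are admissible. -/
structure IsMultiplier (m : E) (ψ ψ' : E → ℝ) : Prop where
  continuous : Continuous ψ
  continuous_deriv : Continuous ψ'
  bounded : ∃ C, ∀ x, |ψ x| ≤ C
  bounded_deriv : ∃ C, ∀ x, |ψ' x| ≤ C
  hasLineDerivAt : ∀ x, HasLineDerivAt ℝ ψ (ψ' x) x m

namespace IsMultiplier

variable {m : E} {ψ ψ' χ χ' : E → ℝ}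

theorem const (m : E) (c : ℝ) : IsMultiplier m (fun _ => c) (fun _ => 0) :=
  ⟨continuous_const, continuous_const, ⟨|c|, fun _ => le_rfl⟩, ⟨0, by simp⟩,
    fun x => by simpa using (hasFDerivAt_const (𝕜 := ℝ) c x).hasLineDerivAt m⟩

theorem mul (hψ : IsMultiplier m ψ ψ') (hχ : IsMultiplier m χ χ') :
    IsMultiplier m (fun x => ψ x * χ x) (fun x => ψ' x * χ x + ψ x * χ' x) where
  continuous := hψ.continuous.mul hχ.continuous
  continuous_deriv := (hψ.continuous_deriv.mul hχ.continuous).add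
    (hψ.continuous.mul hχ.continuous_deriv)
  bounded := bounded_mul hψ.bounded hχ.bounded
  bounded_deriv := bounded_add (bounded_mul hψ.bounded_deriv hχ.bounded)
    (bounded_mul hψ.bounded hχ.bounded_deriv)
  hasLineDerivAt x := by
    have h := HasDerivAt.mul (hψ.hasLineDerivAt x) (hχ.hasLineDerivAt x)
    simpa only [zero_smul, add_zero] using! h

theorem comp_sub_const (hψ : IsMultiplier m ψ ψ') (a : E) :
    IsMultiplier m (fun x => ψ (x - a)) (fun x => ψ' (x - a)) where
  continuous := hψ.continuous.comp (continuous_sub_right a)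
  continuous_deriv := hψ.continuous_deriv.comp (continuous_sub_right a)
  bounded := hψ.bounded.imp fun _ hC x => hC _
  bounded_deriv := hψ.bounded_deriv.imp fun _ hC x => hC _
  hasLineDerivAt x := by
    have h := hψ.hasLineDerivAt (x - a)
    simpa only [HasLineDerivAt, add_sub_right_comm] using h

theorem congr (hψ : IsMultiplier m ψ ψ') (h : ∀ x, ψ x = χ x) (h' : ∀ x, ψ' x = χ' x) :
    IsMultiplier m χ χ' :=
  funext h ▸ funext h' ▸ hψ

end IsMultiplier

theorem hasLineDerivAt_inner_clm [NormedAddCommGroup F] [InnerProductSpace ℂ F] (M : F →L[ℂ] F)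
    (φ χ : 𝓢(E, F)) (m x : E) :
    HasLineDerivAt ℝ (fun x => inner ℂ (φ x) (M (χ x)))
      (inner ℂ (∂_{m} φ x) (M (χ x)) + inner ℂ (φ x) (M (∂_{m} χ x))) x m := by
  have hφ := (φ.differentiable x).hasFDerivAt
  have hχ := ((M.restrictScalars ℝ).hasFDerivAt).comp x (χ.differentiable x).hasFDerivAt
  have hval : inner ℂ (∂_{m} φ x) (M (χ x)) + inner ℂ (φ x) (M (∂_{m} χ x)) =
      ((fderivInnerCLM ℂ (φ x, M (χ x))).comp ((fderiv ℝ φ x).prod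
        ((M.restrictScalars ℝ).comp (fderiv ℝ χ x)))) m := by
    simp [SchwartzMap.lineDerivOp_apply_eq_fderiv, fderivInnerCLM_apply, add_comm]
  rw [hval]
  exact (hφ.inner ℂ hχ).hasLineDerivAt m

variable [MeasurableSpace E] [BorelSpace E] [FiniteDimensional ℝ E]

/-- `f'` is the weak derivative of the integrable function `f` in the direction `m`, tested against
multipliers. -/
structure HasWeakDeriv (m : E) (f f' : E → ℂ) : Prop where
  integrable : Integrable f
  integrable_deriv : Integrable f'
  ibp : ∀ ψ ψ', IsMultiplier m ψ ψ' → ∫ x, (ψ' x : ℂ) * f x = -∫ x, (ψ x : ℂ) * f' x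

theorem HasWeakDeriv.of_hasLineDerivAt {m : E} {f f' : E → ℂ} (hf : Integrable f)
    (hf' : Integrable f') (h : ∀ x, HasLineDerivAt ℝ f (f' x) x m) : HasWeakDeriv m f f' := by
  refine ⟨hf, hf', fun ψ ψ' hψ => ?_⟩
  have h1 := integrable_ofReal_mul hψ.continuous_deriv hψ.bounded_deriv hf
  have h2 := integrable_ofReal_mul hψ.continuous hψ.bounded hf'
  have h3 := integrable_ofReal_mul hψ.continuous hψ.bounded hf
  have key := integral_bilinear_hasLineDerivAt_right_eq_neg_left_of_integrable
    (B := ContinuousLinearMap.lsmul ℝ ℝ (E := ℂ)) (f := ψ) (f' := ψ') (g := f) (g' := f')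
    (v := m) (μ := volume) (by simpa using h1) (by simpa using h2) (by simpa using h3)
    (fun x _ => hψ.hasLineDerivAt x) (fun x _ => h x)
  simp only [ContinuousLinearMap.lsmul_apply, Complex.real_smul] at key
  rw [key, neg_neg]

theorem HasWeakDeriv.congr {m : E} {f f' g g' : E → ℂ} (h : HasWeakDeriv m f f')
    (hf : f =ᵐ[volume] g) (hf' : f' =ᵐ[volume] g') : HasWeakDeriv m g g' := by
  refine ⟨h.integrable.congr hf, h.integrable_deriv.congr hf', fun ψ ψ' hψ => ?_⟩
  rw [← integral_congr_ae (hf.mono fun x hx => congrArg ((ψ' x : ℂ) * ·) hx), h.ibp ψ ψ' hψ,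
    integral_congr_ae (hf'.mono fun x hx => congrArg ((ψ x : ℂ) * ·) hx)]

theorem hasWeakDeriv_testFunction {φ : E → ℝ} (hφ : ContDiff ℝ ∞ φ) (hc : HasCompactSupport φ)
    (m : E) : HasWeakDeriv m (fun x => (φ x : ℂ)) (fun x => (fderiv ℝ φ x m : ℂ)) := by
  have h1 : Integrable φ := hφ.continuous.integrable_of_hasCompactSupport hc
  have h2 : Integrable fun x => fderiv ℝ φ x m :=
    ((hφ.continuous_fderiv (by simp)).clm_apply continuous_const).integrable_of_hasCompactSupport
      (hc.fderiv_apply ℝ m)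
  refine .of_hasLineDerivAt h1.ofReal h2.ofReal fun x => ?_
  exact (Complex.ofRealCLM.hasFDerivAt.comp x
    ((hφ.differentiable (by simp)) x).hasFDerivAt).hasLineDerivAt m

variable [NormedAddCommGroup F] [InnerProductSpace ℂ F]

theorem hasWeakDeriv_inner_schwartz (M : F →L[ℂ] F) (φ χ : 𝓢(E, F)) (m : E) :
    HasWeakDeriv m (fun x => inner ℂ (φ.toLp 2 volume x) (M (χ.toLp 2 volume x)))
      (fun x => inner ℂ ((∂_{m} φ).toLp 2 volume x) (M (χ.toLp 2 volume x)) +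
        inner ℂ (φ.toLp 2 volume x) (M ((∂_{m} χ).toLp 2 volume x))) := by
  have hf : (fun x => inner ℂ (φ.toLp 2 volume x) (M (χ.toLp 2 volume x))) =ᵐ[volume]
      fun x => inner ℂ (φ x) (M (χ x)) := by
    filter_upwards [φ.coeFn_toLp 2 volume, χ.coeFn_toLp 2 volume] with x hφ hχ
    rw [hφ, hχ]
  have hf' : (fun x => inner ℂ ((∂_{m} φ).toLp 2 volume x) (M (χ.toLp 2 volume x)) +
        inner ℂ (φ.toLp 2 volume x) (M ((∂_{m} χ).toLp 2 volume x))) =ᵐ[volume]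
      fun x => inner ℂ (∂_{m} φ x) (M (χ x)) + inner ℂ (φ x) (M (∂_{m} χ x)) := by
    filter_upwards [φ.coeFn_toLp 2 volume, χ.coeFn_toLp 2 volume, (∂_{m} φ).coeFn_toLp 2 volume,
      (∂_{m} χ).coeFn_toLp 2 volume] with x hφ hχ hφ' hχ'
    rw [hφ, hχ, hφ', hχ']
  have hi' := (integrable_inner_clm M ((∂_{m} φ).toLp 2) (χ.toLp 2 volume)).add
    (integrable_inner_clm M (φ.toLp 2) ((∂_{m} χ).toLp 2 volume))
  exact (HasWeakDeriv.of_hasLineDerivAt ((integrable_inner_clm M _ _).congr hf) (hi'.congr hf')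
    (hasLineDerivAt_inner_clm M φ χ m)).congr hf.symm hf'.symm

theorem HasL2Deriv.hasWeakDeriv_inner {m : E} {u g w h : Lp F 2 (volume : Measure E)}
    (hu : HasL2Deriv m u g) (hw : HasL2Deriv m w h) (M : F →L[ℂ] F) :
    HasWeakDeriv m (fun x => inner ℂ (u x) (M (w x)))
      (fun x => inner ℂ (g x) (M (w x)) + inner ℂ (u x) (M (h x))) := by
  obtain ⟨φ, hφ, hφ'⟩ := hu
  obtain ⟨χ, hχ, hχ'⟩ := hw
  refine ⟨integrable_inner_clm M u w, (integrable_inner_clm M g w).add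
    (integrable_inner_clm M u h), fun ψ ψ' hψ => ?_⟩
  obtain ⟨T, hT⟩ :=
    exists_clm_integral_mul_inner_clm (μ := volume) hψ.continuous hψ.bounded M
  obtain ⟨T', hT'⟩ :=
    exists_clm_integral_mul_inner_clm (μ := volume) hψ.continuous_deriv hψ.bounded_deriv M
  have hsum (a b c d : Lp F 2 (volume : Measure E)) :
      ∫ x, (ψ x : ℂ) * (inner ℂ (a x) (M (b x)) + inner ℂ (c x) (M (d x))) =
        inner ℂ a (T b) + inner ℂ c (T d) := by
    simp only [mul_add, ← hT]
    exact integral_add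
      (integrable_ofReal_mul hψ.continuous hψ.bounded (integrable_inner_clm M a b))
      (integrable_ofReal_mul hψ.continuous hψ.bounded (integrable_inner_clm M c d))
  rw [hT', hsum]
  have hschwartz (j : ℕ) : inner ℂ ((φ j).toLp 2) (T' ((χ j).toLp 2)) =
      -(inner ℂ ((∂_{m} (φ j)).toLp 2) (T ((χ j).toLp 2)) +
        inner ℂ ((φ j).toLp 2) (T ((∂_{m} (χ j)).toLp 2))) := by
    rw [← hT', ← hsum]
    exact (hasWeakDeriv_inner_schwartz M (φ j) (χ j) m).ibp ψ ψ' hψ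
  have hlim := ((hφ'.inner (𝕜 := ℂ) ((T.continuous.tendsto w).comp hχ)).add
    (hφ.inner ((T.continuous.tendsto h).comp hχ'))).neg
  refine tendsto_nhds_unique (hφ.inner ((T'.continuous.tendsto w).comp hχ)) ?_
  simpa only [Function.comp_apply, hschwartz] using hlim

end WeakDerivative

/-! ### The regularised norm and Hardy's inequality -/

section RegularizedNorm

variable {E : Type*} [NormedAddCommGroup E]

/-- The regularisation `√(|z|² + δ²)` of the norm. Its reciprocal is a smooth approximation of the
Coulomb potential from below. -/
def regNorm (δ : ℝ) (z : E) : ℝ := √(‖z‖ ^ 2 + δ ^ 2)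

theorem regNorm_sq (δ : ℝ) (z : E) : regNorm δ z ^ 2 = ‖z‖ ^ 2 + δ ^ 2 :=
  Real.sq_sqrt (by positivity)

theorem regNorm_pos {δ : ℝ} (hδ : 0 < δ) (z : E) : 0 < regNorm δ z :=
  Real.sqrt_pos.2 (by positivity)

theorem le_regNorm (δ : ℝ) (z : E) : δ ≤ regNorm δ z :=
  Real.le_sqrt_of_sq_le (by nlinarith [sq_nonneg ‖z‖])

theorem norm_le_regNorm (δ : ℝ) (z : E) : ‖z‖ ≤ regNorm δ z :=
  Real.le_sqrt_of_sq_le (by nlinarith [sq_nonneg δ])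

theorem regNorm_inv_nonneg (δ : ℝ) (z : E) : 0 ≤ (regNorm δ z)⁻¹ :=
  inv_nonneg.2 (Real.sqrt_nonneg _)

theorem regNorm_inv_le {δ : ℝ} (hδ : 0 < δ) (z : E) : (regNorm δ z)⁻¹ ≤ δ⁻¹ :=
  inv_anti₀ hδ (le_regNorm δ z)

theorem regNorm_inv_le_norm_inv (δ : ℝ) {z : E} (hz : z ≠ 0) : (regNorm δ z)⁻¹ ≤ ‖z‖⁻¹ :=
  inv_anti₀ (norm_pos_iff.2 hz) (norm_le_regNorm δ z)

theorem norm_mul_regNorm_inv_le_one (δ : ℝ) (z : E) : ‖z‖ * (regNorm δ z)⁻¹ ≤ 1 :=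
  div_le_one_of_le₀ (norm_le_regNorm δ z) (Real.sqrt_nonneg _)

@[fun_prop]
theorem continuous_regNorm (δ : ℝ) : Continuous (regNorm δ : E → ℝ) := by
  unfold regNorm
  fun_prop

theorem continuous_regNorm_inv {δ : ℝ} (hδ : 0 < δ) : Continuous fun z : E => (regNorm δ z)⁻¹ :=
  (continuous_regNorm δ).inv₀ fun z => (regNorm_pos hδ z).ne'

theorem tendsto_regNorm_inv {z : E} (hz : z ≠ 0) :
    Tendsto (fun δ => (regNorm δ z)⁻¹) (𝓝[>] 0) (𝓝 ‖z‖⁻¹) := by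
  have hc : Continuous fun δ : ℝ => regNorm δ z := by
    unfold regNorm
    fun_prop
  have h0 : regNorm 0 z = ‖z‖ := by simp [regNorm]
  exact (h0 ▸ (hc.tendsto 0).mono_left nhdsWithin_le_nhds).inv₀ (norm_ne_zero_iff.2 hz)

variable [InnerProductSpace ℝ E]

theorem hasFDerivAt_regNorm_inv {δ : ℝ} (hδ : 0 < δ) (z : E) :
    HasFDerivAt (fun z => (regNorm δ z)⁻¹) (-(regNorm δ z)⁻¹ ^ 3 • innerSL ℝ z) z := by
  have hp := regNorm_pos hδ z
  have hsq : HasFDerivAt (fun z : E => ‖z‖ ^ 2 + δ ^ 2) (2 • innerSL ℝ z) z :=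
    (hasStrictFDerivAt_norm_sq z).hasFDerivAt.add_const _
  have h := (hasDerivAt_inv hp.ne').comp_hasFDerivAt z (hsq.sqrt (by positivity))
  refine HasFDerivAt.congr_fderiv h ?_
  change -(regNorm δ z ^ 2)⁻¹ • (1 / (2 * regNorm δ z)) • 2 • innerSL ℝ z = _
  ext v
  simp only [smul_apply, innerSL_apply_apply, smul_eq_mul, nsmul_eq_mul, Nat.cast_ofNat]
  field_simp

theorem abs_inner_mul_regNorm_inv_le (δ : ℝ) (z v : E) :
    |inner ℝ z v * (regNorm δ z)⁻¹| ≤ ‖v‖ := by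
  rw [abs_mul, abs_of_nonneg (regNorm_inv_nonneg δ z)]
  calc |inner ℝ z v| * (regNorm δ z)⁻¹ ≤ ‖z‖ * ‖v‖ * (regNorm δ z)⁻¹ := by
        gcongr
        exacts [regNorm_inv_nonneg δ z, abs_real_inner_le_norm z v]
    _ = ‖z‖ * (regNorm δ z)⁻¹ * ‖v‖ := by ring
    _ ≤ ‖v‖ := mul_le_of_le_one_left (norm_nonneg v) (norm_mul_regNorm_inv_le_one δ z)

theorem isMultiplier_regNorm_inv {δ : ℝ} (hδ : 0 < δ) (m : E) :
    IsMultiplier m (fun z => (regNorm δ z)⁻¹)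
      (fun z => -(inner ℝ z m * (regNorm δ z)⁻¹ ^ 3)) := by
  have hb : ∃ C, ∀ z : E, |(regNorm δ z)⁻¹| ≤ C := ⟨δ⁻¹, fun z => by
    rw [abs_of_nonneg (regNorm_inv_nonneg δ z)]
    exact regNorm_inv_le hδ z⟩
  have hc := continuous_regNorm_inv (E := E) hδ
  refine ⟨hc, by fun_prop, hb, ?_, fun z => ?_⟩
  · obtain ⟨C, hC⟩ := bounded_mul ⟨‖m‖, fun z => abs_inner_mul_regNorm_inv_le δ z m⟩
      (bounded_mul hb hb)
    refine ⟨C, fun z => ?_⟩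
    rw [abs_neg]
    convert hC z using 2
    ring
  · refine (hasFDerivAt_regNorm_inv hδ z).hasLineDerivAt m |>.congr_deriv ?_
    simp only [smul_apply, innerSL_apply_apply, smul_eq_mul]
    ring

theorem isMultiplier_inner_mul_regNorm_inv {δ : ℝ} (hδ : 0 < δ) (m v : E) :
    IsMultiplier m (fun z => inner ℝ z v * (regNorm δ z)⁻¹)
      (fun z => inner ℝ m v * (regNorm δ z)⁻¹ -
        inner ℝ z v * inner ℝ z m * (regNorm δ z)⁻¹ ^ 3) := by
  have hψ := isMultiplier_regNorm_inv hδ m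
  have hc := hψ.continuous
  have hlin (w : E) : ∃ C, ∀ z, |inner ℝ z w * (regNorm δ z)⁻¹| ≤ C :=
    ⟨‖w‖, fun z => abs_inner_mul_regNorm_inv_le δ z w⟩
  refine ⟨by fun_prop, by fun_prop, hlin v, ?_, fun z => ?_⟩
  · obtain ⟨C, hC⟩ := bounded_add (bounded_mul ⟨|inner ℝ m v|, fun _ => le_rfl⟩ hψ.bounded)
      (bounded_mul (bounded_mul (hlin v) (hlin m))
        (bounded_mul ⟨|-1|, fun _ => le_rfl⟩ hψ.bounded))
    refine ⟨C, fun z => ?_⟩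
    convert hC z using 2
    ring
  · have h := ((hasFDerivAt_id (𝕜 := ℝ) z).inner ℝ (hasFDerivAt_const v z)).mul
      (hasFDerivAt_regNorm_inv hδ z)
    refine (h.hasLineDerivAt m).congr_deriv ?_
    simp only [add_apply, smul_apply, innerSL_apply_apply, smul_eq_mul, id_eq,
      ContinuousLinearMap.comp_apply, ContinuousLinearMap.prod_apply, fderivInnerCLM_apply,
      ContinuousLinearMap.id_apply, zero_apply, inner_zero_right]
    ring

end RegularizedNorm

section Hardy

theorem integrable_norm_sq {α F : Type*} [MeasurableSpace α] {μ : Measure α}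
    [NormedAddCommGroup F] (u : Lp F 2 μ) : Integrable (fun x => ‖u x‖ ^ 2) μ :=
  (memLp_two_iff_integrable_sq_norm (Lp.aestronglyMeasurable u)).1 (Lp.memLp u)

theorem integral_norm_sq {α F : Type*} [MeasurableSpace α] {μ : Measure α}
    [NormedAddCommGroup F] [InnerProductSpace ℂ F] (u : Lp F 2 μ) :
    ∫ x, ‖u x‖ ^ 2 ∂μ = ‖u‖ ^ 2 := by
  have h : (inner ℂ u u : ℂ) = ((∫ x, ‖u x‖ ^ 2 ∂μ : ℝ) : ℂ) := by
    rw [L2.inner_def, ← integral_complex_ofReal]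
    simp only [inner_self_eq_norm_sq_to_K, Complex.coe_algebraMap, Complex.ofReal_pow]
  simp only [inner_self_eq_norm_sq_to_K, Complex.coe_algebraMap, ← Complex.ofReal_pow] at h
  exact (Complex.ofReal_injective h).symm

theorem neg_mul_two_mul_re_inner_le {F : Type*} [NormedAddCommGroup F] [InnerProductSpace ℂ F]
    {κ : ℝ} (hκ : 0 < κ) (s : ℝ) (v w : F) :
    -(s * (2 * (inner ℂ v w).re)) ≤ κ * ‖v‖ ^ 2 * s ^ 2 + κ⁻¹ * ‖w‖ ^ 2 := by
  calc -(s * (2 * (inner ℂ v w).re)) ≤ |s * (2 * (inner ℂ v w).re)| := neg_le_abs _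
    _ = |s| * (2 * |(inner ℂ v w).re|) := by rw [abs_mul, abs_mul, abs_two]
    _ ≤ |s| * (2 * (‖v‖ * ‖w‖)) := by
        gcongr
        exact (Complex.abs_re_le_norm _).trans (norm_inner_le_norm _ _)
    _ = 2 * (κ * (‖v‖ * |s|)) * (κ⁻¹ * ‖w‖) := by
        field_simp
    _ ≤ κ * ‖v‖ ^ 2 * s ^ 2 + κ⁻¹ * ‖w‖ ^ 2 := by
        have h := mul_nonneg hκ.le (sq_nonneg (‖v‖ * |s| - κ⁻¹ * ‖w‖))
        rw [← sq_abs s]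
        field_simp at h ⊢
        nlinarith

variable {E F : Type*} [NormedAddCommGroup E] [InnerProductSpace ℝ E]

theorem isMultiplier_inner_mul_regNorm_inv_sq {δ : ℝ} (hδ : 0 < δ) (v : E) :
    IsMultiplier v (fun z => inner ℝ z v * (regNorm δ z)⁻¹ ^ 2)
      (fun z => ‖v‖ ^ 2 * (regNorm δ z)⁻¹ ^ 2 -
        2 * inner ℝ z v ^ 2 * (regNorm δ z)⁻¹ ^ 4) := by
  refine ((isMultiplier_inner_mul_regNorm_inv hδ v v).mul (isMultiplier_regNorm_inv hδ v)).congr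
    (fun z => by ring) fun z => ?_
  rw [real_inner_self_eq_norm_sq]
  ring

theorem sum_sq_inner_mul_regNorm_inv_sq_le {ι : Type*} [Fintype ι] (b : OrthonormalBasis ι ℝ E)
    (δ : ℝ) (z : E) :
    ∑ i, (inner ℝ z (b i) * (regNorm δ z)⁻¹ ^ 2) ^ 2 ≤ (regNorm δ z)⁻¹ ^ 2 := by
  calc ∑ i, (inner ℝ z (b i) * (regNorm δ z)⁻¹ ^ 2) ^ 2
      = (‖z‖ * (regNorm δ z)⁻¹) ^ 2 * (regNorm δ z)⁻¹ ^ 2 := by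
        simp only [mul_pow, ← Finset.sum_mul, b.sum_sq_inner_left]
        ring
    _ ≤ (regNorm δ z)⁻¹ ^ 2 := by
        refine mul_le_of_le_one_left (sq_nonneg _) (pow_le_one₀ ?_ ?_)
        exacts [mul_nonneg (norm_nonneg _) (regNorm_inv_nonneg δ z),
          norm_mul_regNorm_inv_le_one δ z]

theorem mul_regNorm_inv_sq_le_sum {ι : Type*} [Fintype ι] (b : OrthonormalBasis ι ℝ E)
    (δ : ℝ) (z : E) :
    (Fintype.card ι - 2) * (regNorm δ z)⁻¹ ^ 2 ≤
      ∑ i, (‖b i‖ ^ 2 * (regNorm δ z)⁻¹ ^ 2 - 2 * inner ℝ z (b i) ^ 2 * (regNorm δ z)⁻¹ ^ 4) := by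
  calc (Fintype.card ι - 2) * (regNorm δ z)⁻¹ ^ 2
      ≤ Fintype.card ι * (regNorm δ z)⁻¹ ^ 2 -
          2 * ∑ i, (inner ℝ z (b i) * (regNorm δ z)⁻¹ ^ 2) ^ 2 := by
        linarith [sum_sq_inner_mul_regNorm_inv_sq_le b δ z]
    _ = _ := by
        rw [Finset.sum_sub_distrib, Finset.mul_sum]
        simp only [b.norm_eq_one, Finset.sum_const, Finset.card_univ, nsmul_eq_mul]
        congr! 2
        · ring
        · ring

variable [MeasurableSpace E] [BorelSpace E] [FiniteDimensional ℝ E] [NormedAddCommGroup F]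

theorem IsMultiplier.integrable_mul {m : E} {ψ ψ' : E → ℝ} (hψ : IsMultiplier m ψ ψ') {f : E → ℝ}
    (hf : Integrable f) : Integrable fun x => ψ x * f x := by
  obtain ⟨C, hC⟩ := hψ.bounded
  exact hf.bdd_mul hψ.continuous.aestronglyMeasurable (ae_of_all _ hC)

theorem IsMultiplier.integrable_deriv_mul {m : E} {ψ ψ' : E → ℝ} (hψ : IsMultiplier m ψ ψ')
    {f : E → ℝ} (hf : Integrable f) : Integrable fun x => ψ' x * f x := by
  obtain ⟨C, hC⟩ := hψ.bounded_deriv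
  exact hf.bdd_mul hψ.continuous_deriv.aestronglyMeasurable (ae_of_all _ hC)

theorem integrable_regNorm_inv_sq_mul_norm_sq {δ : ℝ} (hδ : 0 < δ) (a : E)
    (u : Lp F 2 (volume : Measure E)) :
    Integrable fun x => (regNorm δ (x - a))⁻¹ ^ 2 * ‖u x‖ ^ 2 := by
  have := continuous_regNorm_inv (E := E) hδ
  refine (integrable_norm_sq u).bdd_mul (c := δ⁻¹ ^ 2) (by fun_prop) (ae_of_all _ fun x => ?_)
  rw [Real.norm_of_nonneg (sq_nonneg _)]
  exact pow_le_pow_left₀ (regNorm_inv_nonneg _ _) (regNorm_inv_le hδ _) 2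

variable [InnerProductSpace ℂ F]

theorem HasL2Deriv.integral_deriv_mul_norm_sq {m : E} {u g : Lp F 2 (volume : Measure E)}
    (hu : HasL2Deriv m u g) {ψ ψ' : E → ℝ} (hψ : IsMultiplier m ψ ψ') :
    ∫ x, ψ' x * ‖u x‖ ^ 2 = -∫ x, ψ x * (2 * (inner ℂ (u x) (g x)).re) := by
  have h := (hu.hasWeakDeriv_inner hu (ContinuousLinearMap.id ℂ F)).ibp ψ ψ' hψ
  have hre (x : E) : inner ℂ (g x) (u x) + inner ℂ (u x) (g x) =
      ((2 * (inner ℂ (u x) (g x)).re : ℝ) : ℂ) := by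
    rw [← inner_conj_symm (g x) (u x), add_comm, Complex.add_conj]
  simp only [ContinuousLinearMap.id_apply, hre, inner_self_eq_norm_sq_to_K,
    Complex.coe_algebraMap, ← Complex.ofReal_pow, ← Complex.ofReal_mul] at h
  rw [integral_complex_ofReal, integral_complex_ofReal] at h
  exact_mod_cast h

variable {ι : Type*} [Fintype ι] {b : OrthonormalBasis ι ℝ E} {u : Lp F 2 (volume : Measure E)}
  {g : ι → Lp F 2 (volume : Measure E)}

theorem mul_integral_regNorm_inv_sq_mul_norm_sq_le (hu : ∀ i, HasL2Deriv (b i) u (g i)) {δ : ℝ}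
    (hδ : 0 < δ) (a : E) :
    (Fintype.card ι - 2) * ∫ x, (regNorm δ (x - a))⁻¹ ^ 2 * ‖u x‖ ^ 2 ≤
      ∑ i, -∫ x, inner ℝ (x - a) (b i) * (regNorm δ (x - a))⁻¹ ^ 2 *
        (2 * (inner ℂ (u x) (g i x)).re) := by
  have hψ i := (isMultiplier_inner_mul_regNorm_inv_sq hδ (b i)).comp_sub_const a
  have hint i := (hψ i).integrable_deriv_mul (integrable_norm_sq u)
  simp only [← fun i => (hu i).integral_deriv_mul_norm_sq (hψ i)]
  rw [← integral_finsetSum _ fun i _ => hint i, ← integral_const_mul]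
  refine integral_mono ((integrable_regNorm_inv_sq_mul_norm_sq hδ a u).const_mul _)
    (integrable_finsetSum _ fun i _ => hint i) fun x => ?_
  simp only [← Finset.sum_mul, ← mul_assoc]
  exact mul_le_mul_of_nonneg_right (mul_regNorm_inv_sq_le_sum b δ (x - a)) (sq_nonneg _)

theorem sum_neg_integral_inner_mul_regNorm_inv_sq_le (b : OrthonormalBasis ι ℝ E)
    (u : Lp F 2 (volume : Measure E)) (g : ι → Lp F 2 (volume : Measure E)) {δ κ : ℝ} (hδ : 0 < δ)
    (hκ : 0 < κ) (a : E) :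
    ∑ i, -∫ x, inner ℝ (x - a) (b i) * (regNorm δ (x - a))⁻¹ ^ 2 *
        (2 * (inner ℂ (u x) (g i x)).re) ≤
      κ * (∫ x, (regNorm δ (x - a))⁻¹ ^ 2 * ‖u x‖ ^ 2) + κ⁻¹ * ∑ i, ‖g i‖ ^ 2 := by
  have hψ i := (isMultiplier_inner_mul_regNorm_inv_sq hδ (b i)).comp_sub_const a
  have hint i : Integrable fun x => -(inner ℝ (x - a) (b i) * (regNorm δ (x - a))⁻¹ ^ 2 *
      (2 * (inner ℂ (u x) (g i x)).re)) :=
    ((hψ i).integrable_mul ((L2.integrable_inner (𝕜 := ℂ) u (g i)).re.const_mul 2)).neg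
  have hI := integrable_regNorm_inv_sq_mul_norm_sq hδ a u
  have hg := integrable_finsetSum Finset.univ fun i _ => integrable_norm_sq (g i)
  simp only [← integral_norm_sq, ← integral_neg]
  rw [← integral_finsetSum _ fun i _ => hint i,
    ← integral_finsetSum _ fun i _ => integrable_norm_sq (g i), ← integral_const_mul,
    ← integral_const_mul, ← integral_add (hI.const_mul κ) (hg.const_mul κ⁻¹)]
  refine integral_mono (integrable_finsetSum _ fun i _ => hint i)
    ((hI.const_mul κ).add (hg.const_mul κ⁻¹)) fun x => ?_
  calc _ ≤ ∑ i, (κ * ‖u x‖ ^ 2 * (inner ℝ (x - a) (b i) * (regNorm δ (x - a))⁻¹ ^ 2) ^ 2 +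
        κ⁻¹ * ‖g i x‖ ^ 2) :=
        Finset.sum_le_sum fun i _ => neg_mul_two_mul_re_inner_le hκ _ _ _
    _ ≤ κ * ‖u x‖ ^ 2 * (regNorm δ (x - a))⁻¹ ^ 2 + κ⁻¹ * ∑ i, ‖g i x‖ ^ 2 := by
        rw [Finset.sum_add_distrib, ← Finset.mul_sum, ← Finset.mul_sum]
        gcongr
        exact sum_sq_inner_mul_regNorm_inv_sq_le b δ (x - a)
    _ = _ := by ring

theorem integral_regNorm_inv_sq_mul_norm_sq_le (hd : 2 < Fintype.card ι)
    (hu : ∀ i, HasL2Deriv (b i) u (g i)) {δ : ℝ} (hδ : 0 < δ) (a : E) :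
    ∫ x, (regNorm δ (x - a))⁻¹ ^ 2 * ‖u x‖ ^ 2 ≤
      (2 / (Fintype.card ι - 2)) ^ 2 * ∑ i, ‖g i‖ ^ 2 := by
  have hd' : 0 < (Fintype.card ι : ℝ) - 2 := by
    have : (2 : ℝ) < Fintype.card ι := by exact_mod_cast hd
    linarith
  have h := (mul_integral_regNorm_inv_sq_mul_norm_sq_le hu hδ a).trans
    (sum_neg_integral_inner_mul_regNorm_inv_sq_le b u g hδ (half_pos hd') a)
  have hle : (Fintype.card ι - 2) / 2 * ∫ x, (regNorm δ (x - a))⁻¹ ^ 2 * ‖u x‖ ^ 2 ≤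
      2 / (Fintype.card ι - 2) * ∑ i, ‖g i‖ ^ 2 := by
    rw [inv_div] at h
    linarith
  rw [sq, mul_assoc, ← inv_div, ← div_eq_inv_mul, le_div_iff₀' (by positivity)]
  rwa [inv_div]

theorem lintegral_norm_inv_sq_mul_norm_sq_le (hd : 2 < Fintype.card ι)
    (hu : ∀ i, HasL2Deriv (b i) u (g i)) (a : E) :
    ∫⁻ x, ENNReal.ofReal (‖x - a‖⁻¹ ^ 2 * ‖u x‖ ^ 2) ≤
      ENNReal.ofReal ((2 / (Fintype.card ι - 2)) ^ 2 * ∑ i, ‖g i‖ ^ 2) := by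
  have : Nontrivial E := Module.nontrivial_of_finrank_pos (R := ℝ) (by
    rw [Module.finrank_eq_card_basis b.toBasis]
    lia)
  calc ∫⁻ x, ENNReal.ofReal (‖x - a‖⁻¹ ^ 2 * ‖u x‖ ^ 2)
      = ∫⁻ x, liminf (fun δ => ENNReal.ofReal ((regNorm δ (x - a))⁻¹ ^ 2 * ‖u x‖ ^ 2))
          (𝓝[>] 0) := by
        refine lintegral_congr_ae ?_
        filter_upwards [Measure.ae_ne volume a] with x hx
        exact ((ENNReal.continuous_ofReal.tendsto _).comp
          (((tendsto_regNorm_inv (sub_ne_zero.2 hx)).pow 2).mul_const _)).liminf_eq.symm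
    _ ≤ liminf (fun δ => ∫⁻ x, ENNReal.ofReal ((regNorm δ (x - a))⁻¹ ^ 2 * ‖u x‖ ^ 2))
          (𝓝[>] 0) := by
        refine lintegral_liminf_le' fun δ => AEMeasurable.ennreal_ofReal ?_
        exact (by fun_prop : Measurable fun x => (regNorm δ (x - a))⁻¹ ^ 2).aemeasurable.mul
          (integrable_norm_sq u).aemeasurable
    _ ≤ _ := by
        refine liminf_le_of_frequently_le' (Eventually.frequently ?_)
        filter_upwards [self_mem_nhdsWithin] with δ (hδ : 0 < δ)
        rw [← ofReal_integral_eq_lintegral_ofReal (integrable_regNorm_inv_sq_mul_norm_sq hδ a u)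
          (ae_of_all _ fun x => by positivity)]
        exact ENNReal.ofReal_le_ofReal (integral_regNorm_inv_sq_mul_norm_sq_le hd hu hδ a)

end Hardy

/-! ### Integration by parts against the Coulomb kernel -/

theorem inner_e (z : E3) (k : Fin 3) : inner ℝ z (e k) = z k := by
  simp [e, EuclideanSpace.inner_single_right]

theorem abs_apply_le_norm (z : E3) (k : Fin 3) : |z k| ≤ ‖z‖ := by
  simpa using PiLp.norm_apply_le z k

theorem coulomb_nonneg (z : E3) : 0 ≤ coulomb z := inv_nonneg.2 (norm_nonneg z)

@[fun_prop]
theorem measurable_coulomb : Measurable coulomb := measurable_norm.inv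

/-- The partial derivative `∂ₖ |z|⁻¹ = -zₖ |z|⁻³` of the Coulomb potential (with the value `0` at
the singularity). -/
def coulombDeriv (k : Fin 3) (z : E3) : ℝ := -(z k * coulomb z ^ 3)

@[fun_prop]
theorem measurable_coulombDeriv (k : Fin 3) : Measurable (coulombDeriv k) := by
  unfold coulombDeriv
  fun_prop

theorem abs_neg_apply_mul_pow_le (k : Fin 3) (z : E3) {r : ℝ} (hr : 0 ≤ r) (hz : ‖z‖ * r ≤ 1) :
    |-(z k * r ^ 3)| ≤ r ^ 2 := by
  rw [abs_neg, abs_mul, abs_of_nonneg (pow_nonneg hr 3)]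
  calc |z k| * r ^ 3 ≤ ‖z‖ * r ^ 3 := by
        gcongr
        exact abs_apply_le_norm z k
    _ = ‖z‖ * r * r ^ 2 := by ring
    _ ≤ r ^ 2 := mul_le_of_le_one_left (sq_nonneg r) hz

theorem abs_coulombDeriv_le (k : Fin 3) (z : E3) : |coulombDeriv k z| ≤ coulomb z ^ 2 :=
  abs_neg_apply_mul_pow_le k z (coulomb_nonneg z) mul_inv_le_one

theorem isMultiplier_regNorm_inv_e {δ : ℝ} (hδ : 0 < δ) (k : Fin 3) :
    IsMultiplier (e k) (fun z => (regNorm δ z)⁻¹) (fun z => -(z k * (regNorm δ z)⁻¹ ^ 3)) := by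
  simpa only [inner_e] using isMultiplier_regNorm_inv hδ (e k)

theorem isMultiplier_neg_apply_mul_regNorm_inv_pow {δ : ℝ} (hδ : 0 < δ) (k : Fin 3) :
    IsMultiplier (e k) (fun z => -(z k * (regNorm δ z)⁻¹ ^ 3))
      (fun z => 3 * z k ^ 2 * (regNorm δ z)⁻¹ ^ 5 - (regNorm δ z)⁻¹ ^ 3) := by
  have hinv := isMultiplier_regNorm_inv hδ (e k)
  refine ((IsMultiplier.const (e k) (-1)).mul
    (((isMultiplier_inner_mul_regNorm_inv hδ (e k) (e k)).mul hinv).mul hinv)).congr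
    (fun z => ?_) fun z => ?_
  · rw [inner_e]
    ring
  · have he : inner ℝ (e k) (e k) = (1 : ℝ) := by rw [inner_e]; simp [e]
    rw [he, inner_e]
    ring

theorem tendsto_integral_kernel_mul {E : Type*} [NormedAddCommGroup E] [MeasurableSpace E]
    [BorelSpace E] {μ : Measure E} [NullSingletonClass μ] {K : ℝ → E → ℝ} {K₀ B : E → ℝ} {f : E → ℂ}
    (hK : ∀ δ > 0, Continuous (K δ)) (hB : ∀ δ > 0, ∀ z ≠ 0, |K δ z| ≤ B z)
    (hK₀ : ∀ z ≠ 0, Tendsto (fun δ => K δ z) (𝓝[>] 0) (𝓝 (K₀ z)))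
    (hf : AEStronglyMeasurable f μ) (a : E) (hint : Integrable (fun x => (B (x - a) : ℂ) * f x) μ) :
    Tendsto (fun δ => ∫ x, (K δ (x - a) : ℂ) * f x ∂μ) (𝓝[>] 0)
      (𝓝 (∫ x, (K₀ (x - a) : ℂ) * f x ∂μ)) := by
  have hne : ∀ᵐ x ∂μ, x - a ≠ 0 := (Measure.ae_ne μ a).mono fun x => sub_ne_zero.2
  refine tendsto_integral_filter_of_dominated_convergence (fun x => ‖(B (x - a) : ℂ) * f x‖)
    ?_ ?_ hint.norm ?_
  · filter_upwards [self_mem_nhdsWithin] with δ hδ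
    exact (Complex.continuous_ofReal.comp
      ((hK δ hδ).comp (continuous_sub_right a))).aestronglyMeasurable.mul hf
  · filter_upwards [self_mem_nhdsWithin] with δ hδ
    filter_upwards [hne] with x hx
    rw [norm_mul, norm_mul, Complex.norm_real, Complex.norm_real]
    gcongr
    exact (hB δ hδ _ hx).trans (le_abs_self _)
  · filter_upwards [hne] with x hx
    exact ((Complex.continuous_ofReal.tendsto _).comp (hK₀ _ hx)).mul_const _

theorem tendsto_integral_neg_apply_mul_regNorm_inv_pow (k : Fin 3) (a : E3) {f : E3 → ℂ}
    (hf : AEStronglyMeasurable f)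
    (hint : Integrable fun x => ((coulomb (x - a) ^ 2 : ℝ) : ℂ) * f x) :
    Tendsto (fun δ => ∫ x, ((-((x - a) k * (regNorm δ (x - a))⁻¹ ^ 3) : ℝ) : ℂ) * f x) (𝓝[>] 0)
      (𝓝 (∫ x, (coulombDeriv k (x - a) : ℂ) * f x)) := by
  refine tendsto_integral_kernel_mul (B := fun z => coulomb z ^ 2)
    (fun δ hδ => (isMultiplier_regNorm_inv_e hδ k).continuous_deriv) (fun δ _ z hz => ?_)
    (fun z hz => (((tendsto_regNorm_inv hz).pow 3).const_mul (z k)).neg) hf a hint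
  refine (abs_neg_apply_mul_pow_le k z (regNorm_inv_nonneg δ z)
    (norm_mul_regNorm_inv_le_one δ z)).trans ?_
  exact pow_le_pow_left₀ (regNorm_inv_nonneg δ z) (regNorm_inv_le_norm_inv δ hz) 2

theorem HasWeakDeriv.integral_coulombDeriv {k : Fin 3} {f f' : E3 → ℂ}
    (h : HasWeakDeriv (e k) f f') (a : E3) (hf' : Integrable fun x => (coulomb (x - a) : ℂ) * f' x)
    (hf : Integrable fun x => ((coulomb (x - a) ^ 2 : ℝ) : ℂ) * f x) :
    ∫ x, (coulombDeriv k (x - a) : ℂ) * f x = -∫ x, (coulomb (x - a) : ℂ) * f' x := by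
  refine tendsto_nhds_unique (tendsto_integral_neg_apply_mul_regNorm_inv_pow k a
    h.integrable.aestronglyMeasurable hf) ?_
  have hlim : Tendsto (fun δ => ∫ x, (((regNorm δ (x - a))⁻¹ : ℝ) : ℂ) * f' x) (𝓝[>] 0)
      (𝓝 (∫ x, (coulomb (x - a) : ℂ) * f' x)) :=
    tendsto_integral_kernel_mul (fun δ hδ => continuous_regNorm_inv hδ)
      (fun δ _ z hz => (abs_of_nonneg (regNorm_inv_nonneg δ z)).trans_le
        (regNorm_inv_le_norm_inv δ hz))
      (fun z hz => tendsto_regNorm_inv hz) h.integrable_deriv.aestronglyMeasurable a hf'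
  refine hlim.neg.congr' ?_
  filter_upwards [self_mem_nhdsWithin] with δ hδ
  exact (h.ibp _ _ ((isMultiplier_regNorm_inv_e hδ k).comp_sub_const a)).symm

/-! ### The Coulomb kernel as a fundamental solution -/

/-- The total charge `∫ 3 (1 + |y|²)^{-5/2} dy` of the regularised point source
`-Δ (|y|² + 1)^{-1/2}`. Its value `4π` is never needed, only that it is a positive constant. -/
def pointCharge : ℝ := ∫ y : E3, 3 * (regNorm 1 y)⁻¹ ^ 5

theorem integrable_pointSource : Integrable fun y : E3 => 3 * (regNorm 1 y)⁻¹ ^ 5 := by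
  have h := integrable_rpow_neg_one_add_norm_sq (E := E3) (μ := volume) (r := 5) (by simp; norm_num)
  refine (h.const_mul 3).congr (ae_of_all _ fun y => ?_)
  have hp : 0 ≤ 1 + ‖y‖ ^ 2 := by positivity
  have hreg : regNorm 1 y = (1 + ‖y‖ ^ 2) ^ (1 / 2 : ℝ) := by
    rw [← Real.sqrt_eq_rpow, regNorm, one_pow, add_comm]
  simp only [hreg]
  rw [← Real.rpow_neg hp, ← Real.rpow_natCast ((1 + ‖y‖ ^ 2) ^ (-(1 / 2 : ℝ))), ← Real.rpow_mul hp]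
  norm_num

theorem pointSource_pos (y : E3) : 0 < 3 * (regNorm 1 y)⁻¹ ^ 5 := by
  have := regNorm_pos one_pos y
  positivity

theorem pointCharge_pos : 0 < pointCharge := by
  refine (integral_pos_iff_support_of_nonneg (fun y => (pointSource_pos y).le)
    integrable_pointSource).2 ?_
  have hsupp : (Function.support fun y : E3 => 3 * (regNorm 1 y)⁻¹ ^ 5) = Set.univ :=
    Set.eq_univ_of_forall fun y => (pointSource_pos y).ne'
  rw [hsupp]
  simp

theorem regNorm_smul {δ : ℝ} (hδ : 0 < δ) (y : E3) : regNorm δ (δ • y) = δ * regNorm 1 y := by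
  rw [regNorm, regNorm, norm_smul, Real.norm_of_nonneg hδ.le,
    show (δ * ‖y‖) ^ 2 + δ ^ 2 = δ ^ 2 * (‖y‖ ^ 2 + 1 ^ 2) by ring,
    Real.sqrt_mul (by positivity), Real.sqrt_sq hδ.le]

theorem integral_pointSource_mul_comp {δ : ℝ} (hδ : 0 < δ) (a : E3) (f : E3 → ℂ) :
    ∫ x, ((3 * δ ^ 2 * (regNorm δ (x - a))⁻¹ ^ 5 : ℝ) : ℂ) * f x =
      ∫ y, ((3 * (regNorm 1 y)⁻¹ ^ 5 : ℝ) : ℂ) * f (δ • y + a) := by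
  set G : E3 → ℂ := fun x => ((3 * δ ^ 2 * (regNorm δ x)⁻¹ ^ 5 : ℝ) : ℂ) * f (x + a)
  have hscale := Measure.integral_comp_smul_of_nonneg (volume : Measure E3) G δ (hR := hδ.le)
  rw [finrank_euclideanSpace_fin] at hscale
  calc ∫ x, ((3 * δ ^ 2 * (regNorm δ (x - a))⁻¹ ^ 5 : ℝ) : ℂ) * f x
      = ∫ x, G (x - a) := by simp only [G, sub_add_cancel]
    _ = ∫ x, G x := integral_sub_right_eq_self G a
    _ = (δ ^ 3 : ℝ) • ∫ y, G (δ • y) := by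
        rw [hscale, smul_smul, mul_inv_cancel₀ (by positivity), one_smul]
    _ = ∫ y, ((3 * (regNorm 1 y)⁻¹ ^ 5 : ℝ) : ℂ) * f (δ • y + a) := by
        rw [← integral_smul]
        refine integral_congr_ae (ae_of_all _ fun y => ?_)
        simp only [G, regNorm_smul hδ, Complex.real_smul, ← mul_assoc, ← Complex.ofReal_mul]
        congr 2
        have := regNorm_pos one_pos y
        field_simp

theorem tendsto_integral_pointSource_mul (a : E3) {f : E3 → ℂ} (hf : Continuous f)
    (hb : ∃ C, ∀ x, ‖f x‖ ≤ C) :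
    Tendsto (fun δ => ∫ x, ((3 * δ ^ 2 * (regNorm δ (x - a))⁻¹ ^ 5 : ℝ) : ℂ) * f x)
      (𝓝[>] 0) (𝓝 (pointCharge * f a)) := by
  obtain ⟨C, hC⟩ := hb
  have hlim : Tendsto (fun δ : ℝ => ∫ y, ((3 * (regNorm 1 y)⁻¹ ^ 5 : ℝ) : ℂ) * f (δ • y + a))
      (𝓝[>] 0) (𝓝 (pointCharge * f a)) := by
    rw [pointCharge, ← integral_complex_ofReal, ← integral_mul_const]
    refine tendsto_integral_filter_of_dominated_convergence
      (fun y => 3 * (regNorm 1 y)⁻¹ ^ 5 * C) (Eventually.of_forall fun δ => ?_)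
      (Eventually.of_forall fun δ => ae_of_all _ fun y => ?_)
      (integrable_pointSource.mul_const C) (ae_of_all _ fun y => ?_)
    · exact integrable_pointSource.ofReal.aestronglyMeasurable.mul
        (by fun_prop : Continuous fun y => f (δ • y + a)).aestronglyMeasurable
    · rw [norm_mul, Complex.norm_real, Real.norm_of_nonneg (pointSource_pos y).le]
      exact mul_le_mul_of_nonneg_left (hC _) (pointSource_pos y).le
    · have hc : Continuous fun δ : ℝ => f (δ • y + a) := by fun_prop
      have h0 := (hc.tendsto 0).mono_left (nhdsWithin_le_nhds (s := Set.Ioi 0))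
      rw [zero_smul, zero_add] at h0
      exact h0.const_mul _
  refine hlim.congr' ?_
  filter_upwards [self_mem_nhdsWithin] with δ hδ
  exact (integral_pointSource_mul_comp hδ a f).symm

theorem sum_deriv_regNorm_inv_pow {δ : ℝ} (hδ : 0 < δ) (z : E3) :
    ∑ k, (3 * z k ^ 2 * (regNorm δ z)⁻¹ ^ 5 - (regNorm δ z)⁻¹ ^ 3) =
      -(3 * δ ^ 2 * (regNorm δ z)⁻¹ ^ 5) := by
  have hp := regNorm_pos hδ z
  have hcube : (regNorm δ z)⁻¹ ^ 3 = (‖z‖ ^ 2 + δ ^ 2) * (regNorm δ z)⁻¹ ^ 5 := by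
    rw [← regNorm_sq]
    field_simp
  rw [hcube, EuclideanSpace.real_norm_sq_eq]
  simp only [Fin.sum_univ_three]
  ring

theorem sum_integral_coulombDeriv {f cf : E3 → ℂ} {f' : Fin 3 → E3 → ℂ}
    (h : ∀ k, HasWeakDeriv (e k) f (f' k)) (hcf : Continuous cf) (hb : ∃ C, ∀ x, ‖cf x‖ ≤ C)
    (hae : f =ᵐ[volume] cf) (a : E3)
    (hf' : ∀ k, Integrable fun x => ((coulomb (x - a) ^ 2 : ℝ) : ℂ) * f' k x) :
    ∑ k, ∫ x, (coulombDeriv k (x - a) : ℂ) * f' k x = pointCharge * cf a := by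
  refine tendsto_nhds_unique (tendsto_finsetSum _ fun k _ =>
    tendsto_integral_neg_apply_mul_regNorm_inv_pow k a (h k).integrable_deriv.aestronglyMeasurable
      (hf' k)) ((tendsto_integral_pointSource_mul a hcf hb).congr' ?_)
  filter_upwards [self_mem_nhdsWithin] with δ hδ
  have hψ k := (isMultiplier_neg_apply_mul_regNorm_inv_pow hδ k).comp_sub_const a
  calc ∫ x, ((3 * δ ^ 2 * (regNorm δ (x - a))⁻¹ ^ 5 : ℝ) : ℂ) * cf x
      = -∫ x, ∑ k, ((3 * (x - a) k ^ 2 * (regNorm δ (x - a))⁻¹ ^ 5 -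
          (regNorm δ (x - a))⁻¹ ^ 3 : ℝ) : ℂ) * f x := by
        rw [← integral_neg]
        refine integral_congr_ae ?_
        filter_upwards [hae] with x hx
        rw [← Finset.sum_mul, ← Complex.ofReal_sum, sum_deriv_regNorm_inv_pow hδ, hx,
          Complex.ofReal_neg, neg_mul, neg_neg]
    _ = -∑ k, ∫ x, ((3 * (x - a) k ^ 2 * (regNorm δ (x - a))⁻¹ ^ 5 -
          (regNorm δ (x - a))⁻¹ ^ 3 : ℝ) : ℂ) * f x := by
        rw [integral_finsetSum _ fun k _ => integrable_ofReal_mul (hψ k).continuous_deriv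
          (hψ k).bounded_deriv (h k).integrable]
    _ = _ := by
        rw [← Finset.sum_neg_distrib]
        exact Finset.sum_congr rfl fun k _ => by rw [(h k).ibp _ _ (hψ k), neg_neg]

/-! ### Sobolev spinors -/

/-- `u ∈ H¹(ℝ³; ℂ²)`. -/
def InH1 (u : HL) : Prop := MemSobolev (1 : ℝ) 2 (u : 𝓢'(E3, C2))

theorem inH1_toLp (χ : 𝓢(E3, C2)) : InH1 (χ.toLp 2) := by
  rw [InH1, Lp.toTemperedDistribution_toLp_eq]
  exact χ.memSobolev

theorem InH2.inH1 {u : HL} (hu : InH2 u) : InH1 u := MemSobolev.mono one_le_two hu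

theorem InH1.weakPartial_spec {u : HL} (hu : InH1 u) (k : Fin 3) :
    (weakPartial k u : 𝓢'(E3, C2)) = ∂_{e k} (u : 𝓢'(E3, C2)) := by
  have hex : ∃ g : HL, (g : 𝓢'(E3, C2)) = ∂_{e k} (u : 𝓢'(E3, C2)) :=
    (memSobolev_zero_iff.1 (by simpa using MemSobolev.lineDerivOp (m := e k) hu)).imp
      fun _ => Eq.symm
  rw [weakPartial, dif_pos hex]
  exact hex.choose_spec

theorem InH1.hasL2Deriv {u : HL} (hu : InH1 u) (k : Fin 3) :
    HasL2Deriv (e k) u (weakPartial k u) :=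
  hasL2Deriv_of_memSobolev_one hu (hu.weakPartial_spec k)

theorem InH2.inH1_weakPartial {u : HL} (hu : InH2 u) (k : Fin 3) : InH1 (weakPartial k u) := by
  have h := MemSobolev.lineDerivOp (m := e k) hu
  rw [show (2 : ℝ) - 1 = 1 by norm_num] at h
  rwa [InH1, hu.inH1.weakPartial_spec]

theorem InH2.weakLaplacian_spec {u : HL} (hu : InH2 u) :
    (weakLaplacian u : 𝓢'(E3, C2)) = Δ (u : 𝓢'(E3, C2)) := by
  have hex : ∃ g : HL, (g : 𝓢'(E3, C2)) = Δ (u : 𝓢'(E3, C2)) :=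
    (memSobolev_zero_iff.1 (by simpa using MemSobolev.laplacian hu)).imp fun _ => Eq.symm
  rw [weakLaplacian, dif_pos hex]
  exact hex.choose_spec

theorem lineDerivOp_lineDerivOp_comm {E F : Type*} [NormedAddCommGroup E] [InnerProductSpace ℝ E]
    [FiniteDimensional ℝ E] [MeasurableSpace E] [BorelSpace E] [NormedAddCommGroup F]
    [NormedSpace ℂ F] (m l : E) (f : 𝓢'(E, F)) : ∂_{m} (∂_{l} f) = ∂_{l} (∂_{m} f) := by
  have h (m l : E) : ∂_{m} (∂_{l} f) = (2 * Real.pi * Complex.I) • (2 * Real.pi * Complex.I) •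
      TemperedDistribution.fourierMultiplierCLM F ((fun x => ((inner ℝ x l : ℝ) : ℂ)) *
        fun x => ((inner ℝ x m : ℝ) : ℂ)) f := by
    rw [lineDeriv_eq_fourierMultiplierCLM, lineDeriv_eq_fourierMultiplierCLM, map_smul,
      fourierMultiplierCLM_fourierMultiplierCLM_apply (by fun_prop) (by fun_prop)]
  rw [h, h, mul_comm fun x => ((inner ℝ x l : ℝ) : ℂ)]

theorem InH2.weakPartial_comm {u : HL} (hu : InH2 u) (k l : Fin 3) :
    weakPartial k (weakPartial l u) = weakPartial l (weakPartial k u) :=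
  eq_of_toTemperedDistribution_eq <| by
    rw [(hu.inH1_weakPartial l).weakPartial_spec, (hu.inH1_weakPartial k).weakPartial_spec,
      hu.inH1.weakPartial_spec, hu.inH1.weakPartial_spec, lineDerivOp_lineDerivOp_comm]

theorem basisFun_eq_e (k : Fin 3) : EuclideanSpace.basisFun (Fin 3) ℝ k = e k :=
  EuclideanSpace.basisFun_apply _ _ k

theorem InH2.weakLaplacian_eq_sum {u : HL} (hu : InH2 u) :
    weakLaplacian u = ∑ k, weakPartial k (weakPartial k u) :=
  eq_of_toTemperedDistribution_eq <| by
    rw [hu.weakLaplacian_spec, ← Lp.toTemperedDistributionCLM_apply (∑ k, _), map_sum,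
      laplacian_eq_sum (EuclideanSpace.basisFun (Fin 3) ℝ)]
    refine Finset.sum_congr rfl fun k _ => ?_
    rw [Lp.toTemperedDistributionCLM_apply, (hu.inH1_weakPartial k).weakPartial_spec,
      hu.inH1.weakPartial_spec, basisFun_eq_e]

theorem InH2.weakLaplacian_coe {u : HL} (hu : InH2 u) :
    weakLaplacian u =ᵐ[volume] fun x => ∑ k, weakPartial k (weakPartial k u) x := by
  rw [hu.weakLaplacian_eq_sum]
  filter_upwards [Lp.coeFn_finsetSum Finset.univ fun k => weakPartial k (weakPartial k u)]
    with x hx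
  rw [hx, Finset.sum_apply]

theorem InH2.contRep_spec {u : HL} (hu : InH2 u) :
    Continuous (contRep u) ∧ (∃ C, ∀ x, ‖contRep u x‖ ≤ C) ∧ contRep u =ᵐ[volume] u := by
  obtain ⟨f, hf⟩ := exists_boundedContinuous_ae_eq_of_memSobolev (s := 2) (by norm_num) hu
  have hex : ∃ f : E3 → C2, Continuous f ∧ f =ᵐ[volume] u := ⟨f, f.continuous, hf⟩
  have hspec : Continuous (contRep u) ∧ contRep u =ᵐ[volume] u := by
    rw [contRep, dif_pos hex]
    exact hex.choose_spec
  have heq : contRep u = f :=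
    (hspec.1.ae_eq_iff_eq volume f.continuous).1 (hspec.2.trans hf.symm)
  exact ⟨hspec.1, ⟨‖f‖, fun x => heq ▸ f.norm_coe_le_norm x⟩, hspec.2⟩

theorem norm_inner_clm_le {F : Type*} [NormedAddCommGroup F] [InnerProductSpace ℂ F]
    (M : F →L[ℂ] F) (v w : F) : ‖inner ℂ v (M w)‖ ≤ ‖M‖ * (‖v‖ * ‖w‖) := by
  calc ‖inner ℂ v (M w)‖ ≤ ‖v‖ * ‖M w‖ := norm_inner_le_norm _ _
    _ ≤ ‖v‖ * (‖M‖ * ‖w‖) := by gcongr; exact M.le_opNorm w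
    _ = _ := by ring

/-! ### Kernels whose potentials are bounded -/

/-- The integral `∫ |K(x - a)| |F(x)| dx` is bounded uniformly in the centre `a`. This is what
makes Fubini's theorem applicable to the potential of `F` with kernel `K`. -/
structure KernelBound {E : Type*} [Sub E] [MeasureSpace E] (K : E → ℝ) (F : E → ℂ) : Prop where
  measurable : Measurable K
  aestronglyMeasurable : AEStronglyMeasurable F
  bound : ∃ C : NNReal, ∀ a, ∫⁻ x, ‖(K (x - a) : ℂ) * F x‖ₑ ≤ C

namespace KernelBound

variable {E : Type*} [Sub E] [MeasureSpace E]

theorem mul {p r U W : E → ℝ} {F : E → ℂ} [MeasurableSub₂ E] (hp : Measurable p)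
    (hr : Measurable r) (hW : AEMeasurable W) (hF : AEStronglyMeasurable F)
    (hpU : ∃ C : NNReal, ∀ a, ∫⁻ x, ENNReal.ofReal (p (x - a) ^ 2 * U x ^ 2) ≤ C)
    (hrW : ∃ C : NNReal, ∀ a, ∫⁻ x, ENNReal.ofReal (r (x - a) ^ 2 * W x ^ 2) ≤ C)
    (hb : ∃ C, ∀ᵐ x, ‖F x‖ ≤ C * (U x * W x)) : KernelBound (fun z => p z * r z) F := by
  obtain ⟨A, hA⟩ := hpU
  obtain ⟨B, hB⟩ := hrW
  obtain ⟨C, hC⟩ := hb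
  refine ⟨hp.mul hr, hF, ‖C‖₊ * (A + B), fun a => ?_⟩
  have hmeas : AEMeasurable fun x => ENNReal.ofReal (r (x - a) ^ 2 * W x ^ 2) := by fun_prop
  calc ∫⁻ x, ‖((p (x - a) * r (x - a) : ℝ) : ℂ) * F x‖ₑ
      ≤ ∫⁻ x, ‖C‖ₑ * (ENNReal.ofReal (p (x - a) ^ 2 * U x ^ 2) +
          ENNReal.ofReal (r (x - a) ^ 2 * W x ^ 2)) := by
        refine lintegral_mono_ae ?_
        filter_upwards [hC] with x hx
        rw [← ENNReal.ofReal_add (by positivity) (by positivity), ← ofReal_norm, ← ofReal_norm,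
          ← ENNReal.ofReal_mul (norm_nonneg _)]
        refine ENNReal.ofReal_le_ofReal ?_
        calc ‖((p (x - a) * r (x - a) : ℝ) : ℂ) * F x‖
            ≤ |p (x - a) * r (x - a)| * |C * (U x * W x)| := by
              rw [norm_mul, Complex.norm_real, Real.norm_eq_abs]
              gcongr
              exact hx.trans (le_abs_self _)
          _ = |C| * (|p (x - a) * U x| * |r (x - a) * W x|) := by
              simp only [abs_mul]
              ring
          _ ≤ ‖C‖ * (p (x - a) ^ 2 * U x ^ 2 + r (x - a) ^ 2 * W x ^ 2) := by
              rw [Real.norm_eq_abs, ← mul_pow, ← mul_pow, ← sq_abs (p _ * _), ← sq_abs (r _ * _)]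
              gcongr
              nlinarith [sq_nonneg (|p (x - a) * U x| - |r (x - a) * W x|)]
    _ = ‖C‖ₑ * ((∫⁻ x, ENNReal.ofReal (p (x - a) ^ 2 * U x ^ 2)) +
          ∫⁻ x, ENNReal.ofReal (r (x - a) ^ 2 * W x ^ 2)) := by
        rw [lintegral_const_mul' _ _ enorm_ne_top, lintegral_add_right' _ hmeas]
    _ ≤ _ := by
        push_cast
        exact mul_le_mul_right (add_le_add (hA a) (hB a)) _

variable {K : E → ℝ} {F : E → ℂ}

theorem mono (h : KernelBound K F) {K' : E → ℝ} (hm : Measurable K') (hK : ∀ z, |K' z| ≤ |K z|) :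
    KernelBound K' F := by
  obtain ⟨C, hC⟩ := h.bound
  refine ⟨hm, h.aestronglyMeasurable, C, fun a => (lintegral_mono fun x => ?_).trans (hC a)⟩
  rw [enorm_mul, enorm_mul]
  gcongr
  rw [enorm_le_iff_norm_le, Complex.norm_real, Complex.norm_real]
  exact hK _

theorem congr (h : KernelBound K F) {G : E → ℂ} (hFG : F =ᵐ[volume] G) : KernelBound K G := by
  obtain ⟨C, hC⟩ := h.bound
  refine ⟨h.measurable, h.aestronglyMeasurable.congr hFG, C, fun a => (le_of_eq ?_).trans (hC a)⟩
  refine lintegral_congr_ae ?_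
  filter_upwards [hFG] with x hx
  rw [hx]

theorem const_mul (h : KernelBound K F) (c : ℂ) : KernelBound K (fun x => c * F x) := by
  obtain ⟨C, hC⟩ := h.bound
  refine ⟨h.measurable, h.aestronglyMeasurable.const_mul c, ‖c‖₊ * C, fun a => ?_⟩
  calc ∫⁻ x, ‖(K (x - a) : ℂ) * (c * F x)‖ₑ
      = ∫⁻ x, ‖c‖ₑ * ‖(K (x - a) : ℂ) * F x‖ₑ :=
        lintegral_congr fun x => by rw [mul_left_comm, enorm_mul]
    _ = ‖c‖ₑ * ∫⁻ x, ‖(K (x - a) : ℂ) * F x‖ₑ := lintegral_const_mul' _ _ enorm_ne_top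
    _ ≤ _ := by push_cast; exact mul_le_mul_right (hC a) _

variable [MeasurableSub₂ E]

theorem aestronglyMeasurable_mul (h : KernelBound K F) (a : E) :
    AEStronglyMeasurable fun x => (K (x - a) : ℂ) * F x :=
  (Complex.measurable_ofReal.comp
    (h.measurable.comp (measurable_id.sub_const a))).aestronglyMeasurable.mul
    h.aestronglyMeasurable

theorem add (h : KernelBound K F) {G : E → ℂ} (h' : KernelBound K G) :
    KernelBound K (fun x => F x + G x) := by
  obtain ⟨C, hC⟩ := h.bound
  obtain ⟨C', hC'⟩ := h'.bound
  refine ⟨h.measurable, h.aestronglyMeasurable.add h'.aestronglyMeasurable, C + C', fun a => ?_⟩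
  calc ∫⁻ x, ‖(K (x - a) : ℂ) * (F x + G x)‖ₑ
      ≤ ∫⁻ x, (‖(K (x - a) : ℂ) * F x‖ₑ + ‖(K (x - a) : ℂ) * G x‖ₑ) :=
        lintegral_mono fun x => by rw [mul_add]; exact enorm_add_le _ _
    _ = _ := lintegral_add_left' (h.aestronglyMeasurable_mul a).enorm _
    _ ≤ _ := by push_cast; exact add_le_add (hC a) (hC' a)

theorem sum {ι : Type*} (s : Finset ι) {F : ι → E → ℂ} (hK : Measurable K)
    (h : ∀ i ∈ s, KernelBound K (F i)) : KernelBound K (fun x => ∑ i ∈ s, F i x) := by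
  classical
  induction s using Finset.induction_on with
  | empty =>
    simp only [Finset.sum_empty]
    exact ⟨hK, aestronglyMeasurable_const, 0, fun a => by simp⟩
  | insert i s hi ih =>
    simp only [Finset.sum_insert hi]
    exact (h i (Finset.mem_insert_self i s)).add
      (ih fun j hj => h j (Finset.mem_insert_of_mem hj))

theorem integrable (h : KernelBound K F) (a : E) :
    Integrable fun x => (K (x - a) : ℂ) * F x := by
  obtain ⟨C, hC⟩ := h.bound
  exact ⟨h.aestronglyMeasurable_mul a, (hC a).trans_lt ENNReal.coe_lt_top⟩

theorem exists_norm_integral_le (h : KernelBound K F) :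
    ∃ C : ℝ, ∀ a, ∫ x, ‖(K (x - a) : ℂ) * F x‖ ≤ C := by
  obtain ⟨C, hC⟩ := h.bound
  refine ⟨C, fun a => ?_⟩
  rw [integral_norm_eq_lintegral_enorm (h.aestronglyMeasurable_mul a)]
  exact ENNReal.toReal_le_of_le_ofReal C.2 (by simpa using hC a)

section Fubini

variable [SFinite (volume : Measure E)] {ν : Measure E} [SFinite ν] {w : E → ℂ}

theorem integrable_prod (h : KernelBound K F) (hw : Integrable w ν) :
    Integrable (fun p : E × E => w p.2 * ((K (p.1 - p.2) : ℂ) * F p.1))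
      ((volume : Measure E).prod ν) := by
  have hm : AEStronglyMeasurable (fun p : E × E => w p.2 * ((K (p.1 - p.2) : ℂ) * F p.1))
      ((volume : Measure E).prod ν) := by
    refine hw.aestronglyMeasurable.comp_snd.mul (AEStronglyMeasurable.mul ?_
      h.aestronglyMeasurable.comp_fst)
    exact (Complex.measurable_ofReal.comp
      (h.measurable.comp (measurable_fst.sub measurable_snd))).aestronglyMeasurable
  rw [integrable_prod_iff' hm]
  refine ⟨ae_of_all _ fun a => (h.integrable a).const_mul (w a), ?_⟩
  obtain ⟨C, hC⟩ := h.exists_norm_integral_le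
  refine (hw.norm.mul_const C).mono hm.norm.prod_swap.integral_prod_right' (ae_of_all _ fun a => ?_)
  simp only [norm_mul (w a), integral_const_mul]
  rw [norm_mul, norm_mul, norm_norm]
  refine mul_le_mul_of_nonneg_left ?_ (norm_nonneg _)
  rw [Real.norm_of_nonneg (integral_nonneg fun x => norm_nonneg _), Real.norm_eq_abs]
  exact (hC a).trans (le_abs_self C)

theorem integrable_convolution (h : KernelBound K F) (hw : Integrable w ν) :
    Integrable fun x => (∫ a, w a * (K (x - a) : ℂ) ∂ν) * F x := by
  simpa only [← mul_assoc, integral_mul_const] using (h.integrable_prod hw).integral_prod_left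

theorem integral_convolution (h : KernelBound K F) (hw : Integrable w ν) :
    ∫ x, (∫ a, w a * (K (x - a) : ℂ) ∂ν) * F x =
      ∫ a, w a * (∫ x, (K (x - a) : ℂ) * F x) ∂ν := by
  have hswap := integral_integral_swap (f := fun x a => w a * ((K (x - a) : ℂ) * F x))
    (h.integrable_prod hw)
  simp only [integral_const_mul] at hswap
  rw [← hswap]
  simp only [← mul_assoc, integral_mul_const]

end Fubini

end KernelBound

theorem KernelBound.coulombDeriv {F : E3 → ℂ} (h : KernelBound (fun z => coulomb z ^ 2) F)
    (k : Fin 3) : KernelBound (coulombDeriv k) F :=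
  h.mono (measurable_coulombDeriv k) fun z => (abs_coulombDeriv_le k z).trans (le_abs_self _)

theorem InH1.exists_lintegral_coulomb_sq_le {u : HL} (hu : InH1 u) : ∃ C : NNReal,
    ∀ a, ∫⁻ x, ENNReal.ofReal (coulomb (x - a) ^ 2 * ‖u x‖ ^ 2) ≤ C :=
  ⟨_, lintegral_norm_inv_sq_mul_norm_sq_le (b := EuclideanSpace.basisFun (Fin 3) ℝ) (by simp)
    fun k => basisFun_eq_e k ▸ hu.hasL2Deriv k⟩

theorem InH1.kernelBound_coulomb {u : HL} (hu : InH1 u) (w : HL) {F : E3 → ℂ}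
    (hF : AEStronglyMeasurable F) (hb : ∃ C, ∀ᵐ x, ‖F x‖ ≤ C * (‖u x‖ * ‖w x‖)) :
    KernelBound coulomb F := by
  have hw : ∃ C : NNReal, ∀ _ : E3, ∫⁻ x, ENNReal.ofReal (1 ^ 2 * ‖w x‖ ^ 2) ≤ C := by
    refine ⟨Real.toNNReal (‖w‖ ^ 2), fun _ => ?_⟩
    rw [← integral_norm_sq, ← ENNReal.ofReal, ofReal_integral_eq_lintegral_ofReal
      (integrable_norm_sq w) (ae_of_all _ fun x => sq_nonneg _)]
    simp only [one_pow, one_mul, le_rfl]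
  simpa only [mul_one] using KernelBound.mul measurable_coulomb measurable_const
    (Lp.aestronglyMeasurable w).norm.aemeasurable hF hu.exists_lintegral_coulomb_sq_le hw hb

theorem InH1.kernelBound_coulomb_sq {u w : HL} (hu : InH1 u) (hw : InH1 w) {F : E3 → ℂ}
    (hF : AEStronglyMeasurable F) (hb : ∃ C, ∀ᵐ x, ‖F x‖ ≤ C * (‖u x‖ * ‖w x‖)) :
    KernelBound (fun z => coulomb z ^ 2) F := by
  simpa only [sq] using KernelBound.mul measurable_coulomb measurable_coulomb
    (Lp.aestronglyMeasurable w).norm.aemeasurable hF hu.exists_lintegral_coulomb_sq_le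
    hw.exists_lintegral_coulomb_sq_le hb

theorem InH1.kernelBound_inner {u : HL} (hu : InH1 u) (w : HL) (M : C2 →L[ℂ] C2) :
    KernelBound coulomb fun x => inner ℂ (u x) (M (w x)) :=
  hu.kernelBound_coulomb w (integrable_inner_clm M u w).aestronglyMeasurable
    ⟨‖M‖, ae_of_all _ fun _ => norm_inner_clm_le M _ _⟩

theorem InH1.kernelBound_inner_right {w : HL} (hw : InH1 w) (u : HL) (M : C2 →L[ℂ] C2) :
    KernelBound coulomb fun x => inner ℂ (u x) (M (w x)) :=
  hw.kernelBound_coulomb u (integrable_inner_clm M u w).aestronglyMeasurable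
    ⟨‖M‖, ae_of_all _ fun x => by
      simpa only [mul_comm ‖w x‖] using norm_inner_clm_le M (u x) (w x)⟩

theorem InH1.kernelBound_sq_inner {u w : HL} (hu : InH1 u) (hw : InH1 w) (M : C2 →L[ℂ] C2) :
    KernelBound (fun z => coulomb z ^ 2) fun x => inner ℂ (u x) (M (w x)) :=
  hu.kernelBound_coulomb_sq hw (integrable_inner_clm M u w).aestronglyMeasurable
    ⟨‖M‖, ae_of_all _ fun _ => norm_inner_clm_le M _ _⟩

theorem exists_inH1_norm_eq_one {s : Set E3} (hs : IsCompact s) :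
    ∃ χ : HL, InH1 χ ∧ ∀ᵐ x, x ∈ s → ‖χ x‖ = 1 := by
  obtain ⟨R, hR, hsR⟩ := hs.isBounded.subset_closedBall_lt 0 0
  let b : ContDiffBump (0 : E3) := ⟨R, R + 1, hR, by linarith⟩
  let c : C2 := EuclideanSpace.single 0 1
  have hsupp : HasCompactSupport fun x : E3 => (b x : ℝ) • c := b.hasCompactSupport.smul_right
  let φ : 𝓢(E3, C2) := hsupp.toSchwartzMap (b.contDiff.smul contDiff_const)
  have hφ : ∀ x ∈ s, ‖φ x‖ = 1 := fun x hx => by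
    have hbx : b x = 1 := b.one_of_mem_closedBall (hsR hx)
    simp [φ, hbx, c]
  have hae : ∀ᵐ x, x ∈ s → ‖(φ.toLp 2 : HL) x‖ = 1 := by
    filter_upwards [φ.coeFn_toLp 2 volume] with x hx hxs
    rw [hx, hφ x hxs]
  exact ⟨_, inH1_toLp φ, hae⟩

theorem exists_inH1_norm_le_of_isCompact {F : E3 → ℂ} (hF : ∃ C, ∀ x, ‖F x‖ ≤ C) {s : Set E3}
    (hs : IsCompact s) (h0 : ∀ x ∉ s, F x = 0) :
    ∃ χ : HL, InH1 χ ∧ ∃ C, ∀ᵐ x, ‖F x‖ ≤ C * (‖χ x‖ * ‖χ x‖) := by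
  obtain ⟨C, hC⟩ := hF
  obtain ⟨χ, hχ, hone⟩ := exists_inH1_norm_eq_one hs
  refine ⟨χ, hχ, C, ?_⟩
  filter_upwards [hone] with x hx
  by_cases hxs : x ∈ s
  · simpa [hx hxs] using hC x
  · have : 0 ≤ C := (norm_nonneg _).trans (hC x)
    rw [h0 x hxs, norm_zero]
    positivity

theorem kernelBound_coulomb_of_isCompact {F : E3 → ℂ} (hF : AEStronglyMeasurable F)
    (hb : ∃ C, ∀ x, ‖F x‖ ≤ C) {s : Set E3} (hs : IsCompact s) (h0 : ∀ x ∉ s, F x = 0) :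
    KernelBound coulomb F :=
  let ⟨χ, hχ, hle⟩ := exists_inH1_norm_le_of_isCompact hb hs h0
  hχ.kernelBound_coulomb χ hF hle

theorem kernelBound_coulomb_sq_of_isCompact {F : E3 → ℂ} (hF : AEStronglyMeasurable F)
    (hb : ∃ C, ∀ x, ‖F x‖ ≤ C) {s : Set E3} (hs : IsCompact s) (h0 : ∀ x ∉ s, F x = 0) :
    KernelBound (fun z => coulomb z ^ 2) F :=
  let ⟨_, hχ, hle⟩ := exists_inH1_norm_le_of_isCompact hb hs h0
  hχ.kernelBound_coulomb_sq hχ hF hle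

theorem exists_norm_ofReal_le {X : Type*} [TopologicalSpace X] {f : X → ℝ} (hf : Continuous f)
    (hc : HasCompactSupport f) : ∃ C, ∀ x, ‖(f x : ℂ)‖ ≤ C := by
  simpa only [Complex.norm_real] using hc.exists_bound_of_continuous hf

theorem kernelBound_coulomb_of_hasCompactSupport {f : E3 → ℝ} (hf : Continuous f)
    (hc : HasCompactSupport f) : KernelBound coulomb (fun x => (f x : ℂ)) :=
  kernelBound_coulomb_of_isCompact (Complex.continuous_ofReal.comp hf).aestronglyMeasurable
    (exists_norm_ofReal_le hf hc) hc fun x hx => by simp [image_eq_zero_of_notMem_tsupport hx]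

theorem kernelBound_coulomb_sq_of_hasCompactSupport {f : E3 → ℝ} (hf : Continuous f)
    (hc : HasCompactSupport f) : KernelBound (fun z => coulomb z ^ 2) (fun x => (f x : ℂ)) :=
  kernelBound_coulomb_sq_of_isCompact (Complex.continuous_ofReal.comp hf).aestronglyMeasurable
    (exists_norm_ofReal_le hf hc) hc fun x hx => by simp [image_eq_zero_of_notMem_tsupport hx]

/-! ### Potentials of charge distributions -/

section PairPotential

variable {E : Type*} [Sub E]

/-- The convolution `K * (ν₂ - ν₁)`: the potential with kernel `K` of two opposite charge
distributions. -/
def pairPot [MeasurableSpace E] (K : E → ℝ) (ν₁ ν₂ : Measure E) (x : E) : ℝ :=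
  -(∫ y, K (x - y) ∂ν₁) + ∫ y, K (x - y) ∂ν₂

/-- The integral against `ν₂ - ν₁`. -/
def pairIntegral [MeasurableSpace E] (ν₁ ν₂ : Measure E) (f : E → ℂ) : ℂ :=
  -(∫ a, f a ∂ν₁) + ∫ a, f a ∂ν₂

theorem ofReal_pairPot [MeasurableSpace E] (K : E → ℝ) (ν₁ ν₂ : Measure E) (x : E) :
    (pairPot K ν₁ ν₂ x : ℂ) =
      -(∫ y, (1 : ℂ) * (K (x - y) : ℂ) ∂ν₁) + ∫ y, (1 : ℂ) * (K (x - y) : ℂ) ∂ν₂ := by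
  simp only [one_mul, integral_complex_ofReal, pairPot]
  push_cast
  rfl

variable [MeasureSpace E] [MeasurableSub₂ E] [SFinite (volume : Measure E)]
  {K : E → ℝ} {F : E → ℂ} (ν₁ ν₂ : Measure E) [IsFiniteMeasure ν₁] [IsFiniteMeasure ν₂]

theorem KernelBound.integrable_pairPot (h : KernelBound K F) :
    Integrable fun x => (pairPot K ν₁ ν₂ x : ℂ) * F x := by
  simp only [ofReal_pairPot, add_mul, neg_mul]
  exact (h.integrable_convolution (integrable_const 1)).neg.add
    (h.integrable_convolution (integrable_const 1))

theorem KernelBound.integral_pairPot (h : KernelBound K F) :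
    ∫ x, (pairPot K ν₁ ν₂ x : ℂ) * F x =
      pairIntegral ν₁ ν₂ fun a => ∫ x, (K (x - a) : ℂ) * F x := by
  have hint : ∀ (ν : Measure E) [IsFiniteMeasure ν],
      Integrable fun x => (∫ y, (1 : ℂ) * (K (x - y) : ℂ) ∂ν) * F x := fun ν _ =>
    h.integrable_convolution (integrable_const 1)
  simp only [ofReal_pairPot, add_mul, neg_mul]
  rw [integral_add (hint ν₁).fun_neg (hint ν₂), integral_neg,
    h.integral_convolution (integrable_const 1), h.integral_convolution (integrable_const 1)]
  simp only [one_mul, pairIntegral]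

theorem locallyIntegrable_pairPot [TopologicalSpace E] [T2Space E] [LocallyCompactSpace E]
    [OpensMeasurableSpace E]
    (hK : ∀ s : Set E, IsCompact s → KernelBound K (s.indicator fun _ => (1 : ℂ))) :
    LocallyIntegrable (pairPot K ν₁ ν₂) := by
  refine locallyIntegrable_iff.2 fun s hs => ?_
  rw [← integrable_indicator_iff hs.measurableSet]
  refine ((hK s hs).integrable_pairPot ν₁ ν₂).re.congr (ae_of_all _ fun x => ?_)
  by_cases hx : x ∈ s <;> simp [hx]

end PairPotential

theorem kernelBound_coulomb_indicator {s : Set E3} (hs : IsCompact s) :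
    KernelBound coulomb (s.indicator fun _ => (1 : ℂ)) :=
  kernelBound_coulomb_of_isCompact
    (stronglyMeasurable_const.indicator hs.measurableSet).aestronglyMeasurable
    ⟨1, fun x => by by_cases hx : x ∈ s <;> simp [hx]⟩ hs fun x hx => by simp [hx]

theorem kernelBound_coulomb_sq_indicator {s : Set E3} (hs : IsCompact s) :
    KernelBound (fun z => coulomb z ^ 2) (s.indicator fun _ => (1 : ℂ)) :=
  kernelBound_coulomb_sq_of_isCompact
    (stronglyMeasurable_const.indicator hs.measurableSet).aestronglyMeasurable
    ⟨1, fun x => by by_cases hx : x ∈ s <;> simp [hx]⟩ hs fun x hx => by simp [hx]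

/-- The gradient of the potential `|x|⁻¹ * (ν₂ - ν₁)`. -/
def pairGrad (ν₁ ν₂ : Measure E3) (x : E3) : E3 :=
  ∑ k, pairPot (coulombDeriv k) ν₁ ν₂ x • e k

theorem pairGrad_apply (ν₁ ν₂ : Measure E3) (x : E3) (k : Fin 3) :
    pairGrad ν₁ ν₂ x k = pairPot (coulombDeriv k) ν₁ ν₂ x := by
  simp [pairGrad, e, Pi.single_apply]

theorem contDiff_fderiv_apply {E : Type*} [NormedAddCommGroup E] [NormedSpace ℝ E] {φ : E → ℝ}
    (hφ : ContDiff ℝ ∞ φ) (v : E) : ContDiff ℝ ∞ fun x => fderiv ℝ φ x v :=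
  (hφ.fderiv_right (m := ∞) (by simp)).clm_apply contDiff_const

theorem integral_coulombDeriv_testFunction {φ : E3 → ℝ} (hφ : ContDiff ℝ ∞ φ)
    (hc : HasCompactSupport φ) (k : Fin 3) (a : E3) :
    ∫ x, (coulombDeriv k (x - a) : ℂ) * (φ x : ℂ) =
      -∫ x, (coulomb (x - a) : ℂ) * ((fderiv ℝ φ x (e k) : ℝ) : ℂ) :=
  (hasWeakDeriv_testFunction hφ hc (e k)).integral_coulombDeriv a
    ((kernelBound_coulomb_of_hasCompactSupport (contDiff_fderiv_apply hφ (e k)).continuous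
      (hc.fderiv_apply ℝ (e k))).integrable a)
    ((kernelBound_coulomb_sq_of_hasCompactSupport hφ.continuous hc).integrable a)

section WeakGradient

variable (ν₁ ν₂ : Measure E3)

theorem pairIntegral_neg (f : E3 → ℂ) :
    pairIntegral ν₁ ν₂ (fun a => -f a) = -pairIntegral ν₁ ν₂ f := by
  simp only [pairIntegral, integral_neg]
  ring

variable [IsFiniteMeasure ν₁] [IsFiniteMeasure ν₂]

theorem locallyIntegrable_pairPot_coulomb : LocallyIntegrable (pairPot coulomb ν₁ ν₂) :=
  locallyIntegrable_pairPot ν₁ ν₂ fun _ => kernelBound_coulomb_indicator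

theorem locallyIntegrable_pairGrad : LocallyIntegrable (pairGrad ν₁ ν₂) := by
  refine locallyIntegrable_iff.2 fun s hs => integrable_finsetSum _ fun k _ => ?_
  have hk : LocallyIntegrable (pairPot (coulombDeriv k) ν₁ ν₂) :=
    locallyIntegrable_pairPot ν₁ ν₂ fun _ ht => (kernelBound_coulomb_sq_indicator ht).coulombDeriv k
  exact (hk.integrableOn_isCompact hs).smul_const (e k)

theorem isWeakGradient_pairPot : IsWeakGradient (pairPot coulomb ν₁ ν₂) (pairGrad ν₁ ν₂) := by
  refine ⟨locallyIntegrable_pairPot_coulomb ν₁ ν₂, locallyIntegrable_pairGrad ν₁ ν₂,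
    fun φ hφ hc k => ?_⟩
  have hpot := (kernelBound_coulomb_of_hasCompactSupport
    (contDiff_fderiv_apply hφ (e k)).continuous (hc.fderiv_apply ℝ (e k))).integral_pairPot ν₁ ν₂
  have hgrad := ((kernelBound_coulomb_sq_of_hasCompactSupport hφ.continuous
    hc).coulombDeriv k).integral_pairPot ν₁ ν₂
  simp only [integral_coulombDeriv_testFunction hφ hc k] at hgrad
  rw [pairIntegral_neg, ← hpot] at hgrad
  apply Complex.ofReal_injective
  simp only [pairGrad_apply]
  push_cast
  rw [← integral_complex_ofReal, ← integral_complex_ofReal]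
  push_cast
  rw [hgrad, neg_neg]

end WeakGradient

theorem IsWeakGradient.weakGrad {Φ : E3 → ℝ} {G : E3 → E3} (h : IsWeakGradient Φ G) :
    IsWeakGradient Φ (weakGrad Φ) := by
  have hex : ∃ G, IsWeakGradient Φ G := ⟨G, h⟩
  rw [HartreeFock.weakGrad, dif_pos hex]
  exact hex.choose_spec

theorem IsWeakGradient.ae_eq {Φ : E3 → ℝ} {G H : E3 → E3} (hG : IsWeakGradient Φ G)
    (hH : IsWeakGradient Φ H) : G =ᵐ[volume] H := by
  have hcomp : ∀ {H : E3 → E3}, LocallyIntegrable H → ∀ k : Fin 3,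
      LocallyIntegrable fun x => H x k := fun hH k =>
    locallyIntegrable_iff.2 fun s hs =>
      (EuclideanSpace.proj (𝕜 := ℝ) k : E3 →L[ℝ] ℝ).integrable_comp (hH.integrableOn_isCompact hs)
  have hk : ∀ k : Fin 3, ∀ᵐ x, G x k = H x k := fun k => by
    refine ae_eq_of_integral_contDiff_smul_eq (hcomp hG.2.1 k) (hcomp hH.2.1 k) fun φ hφ hc => ?_
    have hGk := hG.2.2 φ hφ hc k
    have hHk := hH.2.2 φ hφ hc k
    simp only [smul_eq_mul, mul_comm (φ _)]
    linarith
  filter_upwards [ae_all_iff.2 hk] with x hx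
  ext k
  exact hx k

/-! ### Distributional Laplacians of potentials -/

theorem measure_ext_of_absolutelyContinuous {E : Type*} [NormedAddCommGroup E] [NormedSpace ℝ E]
    [FiniteDimensional ℝ E] [MeasurableSpace E] [BorelSpace E] {ν₁ ν₂ m : Measure E}
    [IsFiniteMeasure ν₁] [IsFiniteMeasure ν₂] [SigmaFinite m] (h₁ : ν₁ ≪ m)
    (h₂ : ν₂ ≪ m) (h : ∀ φ : E → ℝ, ContDiff ℝ ∞ φ → HasCompactSupport φ →
      ∫ x, φ x ∂ν₁ = ∫ x, φ x ∂ν₂) : ν₁ = ν₂ := by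
  have hae : ∀ᵐ x ∂m, (ν₁.rnDeriv m x).toReal = (ν₂.rnDeriv m x).toReal := by
    refine ae_eq_of_integral_contDiff_smul_eq
      (Measure.integrable_toReal_rnDeriv (μ := ν₁) (ν := m)).locallyIntegrable
      (Measure.integrable_toReal_rnDeriv (μ := ν₂) (ν := m)).locallyIntegrable fun φ hφ hc => ?_
    have hint₁ := integral_rnDeriv_smul (f := φ) h₁
    have hint₂ := integral_rnDeriv_smul (f := φ) h₂
    simp only [smul_eq_mul, mul_comm (φ _)] at hint₁ hint₂ ⊢
    rw [hint₁, hint₂, h φ hφ hc]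
  rw [← Measure.withDensity_rnDeriv_eq _ _ h₁, ← Measure.withDensity_rnDeriv_eq _ _ h₂]
  refine withDensity_congr_ae ?_
  filter_upwards [hae, Measure.rnDeriv_lt_top ν₁ m, Measure.rnDeriv_lt_top ν₂ m]
    with x hx htop₁ htop₂
  exact (ENNReal.toReal_eq_toReal_iff' htop₁.ne htop₂.ne).1 hx

theorem measure_ext_of_forall_testFunction {E : Type*} [NormedAddCommGroup E] [NormedSpace ℝ E]
    [FiniteDimensional ℝ E] [MeasurableSpace E] [BorelSpace E] {ν₁ ν₂ : Measure E}
    [IsFiniteMeasure ν₁] [IsFiniteMeasure ν₂] (h : ∀ φ : E → ℝ, ContDiff ℝ ∞ φ →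
      HasCompactSupport φ → ∫ x, φ x ∂ν₁ = ∫ x, φ x ∂ν₂) : ν₁ = ν₂ :=
  measure_ext_of_absolutelyContinuous (m := ν₁ + ν₂)
    (Measure.le_add_right le_rfl).absolutelyContinuous
    (Measure.le_add_left le_rfl).absolutelyContinuous h

theorem integrable_of_continuous_bounded {X F : Type*} [TopologicalSpace X] [MeasurableSpace X]
    [OpensMeasurableSpace X] [NormedAddCommGroup F] [SecondCountableTopology F] {f : X → F}
    (hf : Continuous f) (hb : ∃ C, ∀ x, ‖f x‖ ≤ C) (ν : Measure X) [IsFiniteMeasure ν] :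
    Integrable f ν :=
  let ⟨C, hC⟩ := hb
  .of_bound hf.aestronglyMeasurable C (ae_of_all _ hC)

theorem signedIntegrable_of_continuous_bounded {f : E3 → ℂ} (hf : Continuous f)
    (hb : ∃ C, ∀ x, ‖f x‖ ≤ C) (ν : SignedMeasure E3) : SignedIntegrable ν f :=
  ⟨integrable_of_continuous_bounded hf hb _, integrable_of_continuous_bounded hf hb _⟩

theorem exists_signedMeasure {α : Type*} [MeasurableSpace α] (ν₁ ν₂ : Measure α)
    [IsFiniteMeasure ν₁] [IsFiniteMeasure ν₂] : ∃ ν : SignedMeasure α,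
      ν.toJordanDecomposition.posPart + ν₁ = ν.toJordanDecomposition.negPart + ν₂ := by
  let ν := ν₂.toSignedMeasure - ν₁.toSignedMeasure
  have hν : ν.toJordanDecomposition.toSignedMeasure = ν₂.toSignedMeasure - ν₁.toSignedMeasure :=
    ν.toSignedMeasure_toJordanDecomposition
  rw [JordanDecomposition.toSignedMeasure, sub_eq_sub_iff_add_eq_add] at hν
  refine ⟨ν, ?_⟩
  rw [← Measure.toSignedMeasure_eq_toSignedMeasure_iff, Measure.toSignedMeasure_add,
    Measure.toSignedMeasure_add, hν, add_comm]

theorem laplacian_eq_sum_fderiv {φ : E3 → ℝ} (hφ : ContDiff ℝ ∞ φ) (x : E3) :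
    (Δ φ) x = ∑ k, fderiv ℝ (fun y => fderiv ℝ φ y (e k)) x (e k) := by
  rw [InnerProductSpace.laplacian_eq_iteratedFDeriv_orthonormalBasis φ
    (EuclideanSpace.basisFun (Fin 3) ℝ)]
  refine Finset.sum_congr rfl fun k _ => ?_
  have hd : DifferentiableAt ℝ (fderiv ℝ φ) x :=
    ((hφ.fderiv_right (m := ∞) (by simp)).differentiable (by simp)) x
  rw [iteratedFDeriv_two_apply, fderiv_clm_apply hd (differentiableAt_const _)]
  simp [e]

theorem kernelBound_coulomb_fderiv_fderiv {φ : E3 → ℝ} (hφ : ContDiff ℝ ∞ φ)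
    (hc : HasCompactSupport φ) (k : Fin 3) : KernelBound coulomb fun x =>
      ((fderiv ℝ (fun y => fderiv ℝ φ y (e k)) x (e k) : ℝ) : ℂ) :=
  kernelBound_coulomb_of_hasCompactSupport
    (contDiff_fderiv_apply (contDiff_fderiv_apply hφ (e k)) (e k)).continuous
    ((hc.fderiv_apply ℝ (e k)).fderiv_apply ℝ (e k))

theorem integral_coulomb_laplacian {φ : E3 → ℝ} (hφ : ContDiff ℝ ∞ φ)
    (hc : HasCompactSupport φ) (a : E3) :
    ∫ x, (coulomb (x - a) : ℂ) * (((Δ φ) x : ℝ) : ℂ) = -(pointCharge * (φ a : ℂ)) := by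
  have hφk := fun k => contDiff_fderiv_apply hφ (e k)
  have hck := fun k => hc.fderiv_apply ℝ (e k)
  rw [← sum_integral_coulombDeriv (cf := fun x => (φ x : ℂ))
    (fun k => hasWeakDeriv_testFunction hφ hc (e k))
    (Complex.continuous_ofReal.comp hφ.continuous) (exists_norm_ofReal_le hφ.continuous hc)
    (ae_eq_refl _) a fun k =>
      (kernelBound_coulomb_sq_of_hasCompactSupport (hφk k).continuous (hck k)).integrable a]
  simp_rw [fun k => integral_coulombDeriv_testFunction (hφk k) (hck k) k a]
  rw [Finset.sum_neg_distrib, neg_neg, ← integral_finsetSum _ fun k _ =>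
    (kernelBound_coulomb_fderiv_fderiv hφ hc k).integrable a]
  simp only [laplacian_eq_sum_fderiv hφ, Complex.ofReal_sum, Finset.mul_sum]

theorem integral_pairPot_laplacian {φ : E3 → ℝ} (hφ : ContDiff ℝ ∞ φ)
    (hc : HasCompactSupport φ) (ν₁ ν₂ : Measure E3) [IsFiniteMeasure ν₁] [IsFiniteMeasure ν₂] :
    ((∫ x, pairPot coulomb ν₁ ν₂ x * (Δ φ) x : ℝ) : ℂ) =
      -(pointCharge * pairIntegral ν₁ ν₂ fun a => (φ a : ℂ)) := by
  have hΔ : KernelBound coulomb fun x => (((Δ φ) x : ℝ) : ℂ) := by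
    simp only [laplacian_eq_sum_fderiv hφ, Complex.ofReal_sum]
    exact KernelBound.sum _ measurable_coulomb fun k _ => kernelBound_coulomb_fderiv_fderiv hφ hc k
  rw [← integral_complex_ofReal]
  push_cast
  rw [hΔ.integral_pairPot ν₁ ν₂]
  simp only [integral_coulomb_laplacian hφ hc, pairIntegral, integral_neg, integral_const_mul]
  ring

section DistribLaplacian

variable (ν₁ ν₂ : Measure E3)

/-- The distribution `-Δ(|x|⁻¹ * ν)`, which is again a measure. -/
abbrev chargeMeasure (ν : Measure E3) : Measure E3 := pointCharge.toNNReal • ν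

theorem pairIntegral_chargeMeasure (f : E3 → ℂ) :
    pairIntegral (chargeMeasure ν₂) (chargeMeasure ν₁) f =
      -(pointCharge * pairIntegral ν₁ ν₂ f) := by
  simp only [pairIntegral, chargeMeasure, integral_smul_nnreal_measure, NNReal.smul_def,
    Real.coe_toNNReal _ pointCharge_pos.le, Complex.real_smul]
  ring

variable [IsFiniteMeasure ν₁] [IsFiniteMeasure ν₂]

theorem signedIntegral_eq_pairIntegral {ν : SignedMeasure E3}
    (h : ν.toJordanDecomposition.posPart + ν₁ = ν.toJordanDecomposition.negPart + ν₂)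
    {f : E3 → ℂ} (hf : Continuous f) (hb : ∃ C, ∀ x, ‖f x‖ ≤ C) :
    signedIntegral ν f = pairIntegral ν₁ ν₂ f := by
  have hint : ∀ (m : Measure E3) [IsFiniteMeasure m], Integrable f m := fun m _ =>
    integrable_of_continuous_bounded hf hb m
  have hsum := congrArg (fun m => ∫ x, f x ∂m) h
  rw [integral_add_measure (hint _) (hint _), integral_add_measure (hint _) (hint _)] at hsum
  rw [signedIntegral, pairIntegral]
  linear_combination hsum

theorem isDistribLaplacian_pairPot_of_add_eq {ν : SignedMeasure E3}
    (h : ν.toJordanDecomposition.posPart + chargeMeasure ν₂ =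
      ν.toJordanDecomposition.negPart + chargeMeasure ν₁) :
    IsDistribLaplacian (pairPot coulomb ν₁ ν₂) ν := by
  refine ⟨locallyIntegrable_pairPot_coulomb ν₁ ν₂, fun φ hφ hc => ?_⟩
  rw [integral_pairPot_laplacian hφ hc,
    signedIntegral_eq_pairIntegral _ _ h (f := fun x => (φ x : ℂ))
      (Complex.continuous_ofReal.comp hφ.continuous) (exists_norm_ofReal_le hφ.continuous hc),
    pairIntegral_chargeMeasure]

theorem add_eq_of_isDistribLaplacian {ν : SignedMeasure E3}
    (h : IsDistribLaplacian (pairPot coulomb ν₁ ν₂) ν) :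
    ν.toJordanDecomposition.posPart + chargeMeasure ν₂ =
      ν.toJordanDecomposition.negPart + chargeMeasure ν₁ := by
  refine measure_ext_of_forall_testFunction fun φ hφ hc => ?_
  have hint : ∀ (m : Measure E3) [IsFiniteMeasure m], Integrable φ m := fun m _ =>
    integrable_of_continuous_bounded hφ.continuous (hc.exists_bound_of_continuous hφ.continuous) m
  have hΔ := h.2 φ hφ hc
  rw [integral_pairPot_laplacian hφ hc, ← pairIntegral_chargeMeasure, pairIntegral,
    signedIntegral] at hΔ
  simp only [integral_complex_ofReal] at hΔ
  rw [integral_add_measure (hint _) (hint _), integral_add_measure (hint _) (hint _)]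
  apply Complex.ofReal_injective
  push_cast
  linear_combination -hΔ

theorem isDistribLaplacian_pairPot : IsDistribLaplacian (pairPot coulomb ν₁ ν₂)
    (distribLaplacian (pairPot coulomb ν₁ ν₂)) := by
  obtain ⟨ν, hν⟩ := exists_signedMeasure (chargeMeasure ν₂) (chargeMeasure ν₁)
  have hex : ∃ ν, IsDistribLaplacian (pairPot coulomb ν₁ ν₂) ν :=
    ⟨ν, isDistribLaplacian_pairPot_of_add_eq ν₁ ν₂ hν⟩
  rw [distribLaplacian, dif_pos hex]
  exact hex.choose_spec

theorem signedIntegral_distribLaplacian_pairPot {f : E3 → ℂ} (hf : Continuous f)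
    (hb : ∃ C, ∀ x, ‖f x‖ ≤ C) : signedIntegral (distribLaplacian (pairPot coulomb ν₁ ν₂)) f =
      -(pointCharge * pairIntegral ν₁ ν₂ f) := by
  rw [signedIntegral_eq_pairIntegral _ _ (add_eq_of_isDistribLaplacian ν₁ ν₂
    (isDistribLaplacian_pairPot ν₁ ν₂)) hf hb, pairIntegral_chargeMeasure]

end DistribLaplacian

/-! ### Pauli matrices -/

theorem sigma_apply (k : Fin 3) (v : C2) (i : Fin 2) :
    sigma k v i = pauli k i 0 * v 0 + pauli k i 1 * v 1 := by
  simp [sigma, Matrix.ofLp_toEuclideanCLM, Matrix.mulVec, dotProduct, Fin.sum_univ_two]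

theorem inner_C2 (v w : C2) : inner ℂ v w = w 0 * conj (v 0) + w 1 * conj (v 1) := by
  simp [PiLp.inner_apply, Fin.sum_univ_two]

theorem inner_sigma_left (k : Fin 3) (v w : C2) :
    inner ℂ (sigma k v) w = inner ℂ v (sigma k w) := by
  fin_cases k <;> simp [inner_C2, sigma_apply, pauli] <;> ring

theorem sigma_sigma_self (k : Fin 3) :
    (sigma k).comp (sigma k) = ContinuousLinearMap.id ℂ C2 := by
  ext v i
  fin_cases k <;> fin_cases i <;> simp [sigma_apply, pauli, ← mul_assoc]

theorem sigma_sigma_succ (k : Fin 3) :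
    (sigma k).comp (sigma (k + 1)) = Complex.I • sigma (k + 2) := by
  ext v i
  fin_cases k <;> fin_cases i <;> simp [sigma_apply, pauli, ← mul_assoc]

theorem sigma_sigma_succ_succ (k : Fin 3) :
    (sigma k).comp (sigma (k + 2)) = -Complex.I • sigma (k + 1) := by
  ext v i
  fin_cases k <;> fin_cases i <;> simp [sigma_apply, pauli, ← mul_assoc]

theorem sum_fin_three_shift (f : Fin 3 → ℂ) (k : Fin 3) :
    ∑ l, f l = f k + f (k + 1) + f (k + 2) := by
  fin_cases k <;> simp [Fin.sum_univ_three] <;> ring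

theorem sum_sigma_sigma {z : Fin 3 → (C2 →L[ℂ] C2) → ℂ}
    (hz : ∀ l (c : ℂ) M, z l (c • M) = c * z l M) (k : Fin 3) :
    ∑ l, z l ((sigma k).comp (sigma l)) = z k (ContinuousLinearMap.id ℂ C2) +
      (Complex.I * z (k + 1) (sigma (k + 2)) - Complex.I * z (k + 2) (sigma (k + 1))) := by
  rw [sum_fin_three_shift _ k, sigma_sigma_self, sigma_sigma_succ, sigma_sigma_succ_succ, hz, hz]
  ring

/-- By the Clifford relations the off-diagonal terms cancel in pairs. -/
theorem sum_sum_sigma_sigma {y : Fin 3 → Fin 3 → (C2 →L[ℂ] C2) → ℂ}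
    (hy : ∀ k l (c : ℂ) M, y k l (c • M) = c * y k l M) (hs : ∀ k l M, y k l M = y l k M) :
    ∑ k, ∑ l, y k l ((sigma k).comp (sigma l)) = ∑ k, y k k (ContinuousLinearMap.id ℂ C2) := by
  simp_rw [fun k => sum_sigma_sigma (hy k) k, Finset.sum_add_distrib]
  rw [add_eq_left]
  simp only [Fin.sum_univ_three]
  simp only [Fin.isValue, zero_add, Fin.reduceAdd]
  rw [hs 1 0, hs 2 0, hs 2 1]
  ring

/-! ### The Dirac operator -/

section Dirac

variable {u v : HL}

theorem diracL_coe (u : HL) : diracL u =ᵐ[volume]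
    fun x => -Complex.I • ∑ k, sigma k (weakPartial k u x) := by
  have h1 := Lp.coeFn_smul (-Complex.I) (∑ k, (sigma k).compLp (weakPartial k u))
  have h2 := Lp.coeFn_finsetSum Finset.univ fun k => (sigma k).compLp (weakPartial k u)
  have h3 : ∀ᵐ x, ∀ k, (sigma k).compLp (weakPartial k u) x = sigma k (weakPartial k u x) :=
    ae_all_iff.2 fun k => (sigma k).coeFn_compLp _
  filter_upwards [h1, h2, h3] with x e1 e2 e3
  rw [diracL, e1, Pi.smul_apply, e2, Finset.sum_apply]
  simp only [e3]

theorem inner_diracL_coe (u v : HL) : (fun x => inner ℂ (diracL u x) (diracL v x)) =ᵐ[volume]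
    fun x => ∑ k, ∑ l, inner ℂ (weakPartial k u x)
      (((sigma k).comp (sigma l)) (weakPartial l v x)) := by
  filter_upwards [diracL_coe u, diracL_coe v] with x h1 h2
  rw [h1, h2, inner_smul_left, inner_smul_right, ← mul_assoc]
  have : conj (-Complex.I) * -Complex.I = 1 := by simp
  rw [this, one_mul, sum_inner]
  refine Finset.sum_congr rfl fun k _ => ?_
  rw [inner_sum]
  refine Finset.sum_congr rfl fun l _ => ?_
  rw [inner_sigma_left]
  rfl
theorem integral_mul_inner_smul (w : E3 → ℂ) (f g : E3 → C2) (c : ℂ) (M : C2 →L[ℂ] C2) :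
    ∫ x, w x * inner ℂ (f x) ((c • M) (g x)) = c * ∫ x, w x * inner ℂ (f x) (M (g x)) := by
  simp only [smul_apply, inner_smul_right, mul_left_comm _ c,
    integral_const_mul]

theorem integral_mul_inner_diracL {w : E3 → ℂ} (hi : ∀ k l, Integrable fun x => w x *
      inner ℂ (weakPartial k u x) (((sigma k).comp (sigma l)) (weakPartial l v x))) :
    ∫ x, w x * inner ℂ (diracL u x) (diracL v x) = ∑ k, ∑ l, ∫ x, w x *
      inner ℂ (weakPartial k u x) (((sigma k).comp (sigma l)) (weakPartial l v x)) := by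
  simp_rw [fun k => (integral_finsetSum Finset.univ fun l _ => hi k l).symm]
  rw [← integral_finsetSum _ fun k _ => integrable_finsetSum _ fun l _ => hi k l]
  refine integral_congr_ae ?_
  filter_upwards [inner_diracL_coe u v] with x hx
  simp only [hx, Finset.mul_sum]

theorem InH2.integral_mul_inner_weakLaplacian (hv : InH2 v) {w : E3 → ℂ}
    (hi : ∀ k, Integrable fun x => w x * inner ℂ (u x) (weakPartial k (weakPartial k v) x)) :
    ∫ x, w x * inner ℂ (u x) (weakLaplacian v x) =
      ∑ k, ∫ x, w x * inner ℂ (u x) (weakPartial k (weakPartial k v) x) := by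
  rw [← integral_finsetSum _ fun k _ => hi k]
  refine integral_congr_ae ?_
  filter_upwards [hv.weakLaplacian_coe] with x hx
  rw [hx, inner_sum, Finset.mul_sum]

theorem InH2.sum_integral_mul_inner_sigma_sigma (hv : InH2 v) {w : E3 → ℂ}
    (hi : ∀ k, Integrable fun x => w x * inner ℂ (u x) (weakPartial k (weakPartial k v) x)) :
    ∑ k, ∑ l, ∫ x, w x * inner ℂ (u x)
        (((sigma k).comp (sigma l)) (weakPartial k (weakPartial l v) x)) =
      ∫ x, w x * inner ℂ (u x) (weakLaplacian v x) := by
  rw [hv.integral_mul_inner_weakLaplacian hi]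
  exact sum_sum_sigma_sigma
    (y := fun k l M => ∫ x, w x * inner ℂ (u x) (M (weakPartial k (weakPartial l v) x)))
    (fun k l c M => integral_mul_inner_smul _ _ _ c M) (fun k l M => by rw [hv.weakPartial_comm])

theorem InH1.integral_inner_weakPartial (hu : InH1 u) (hv : InH1 v) (M : C2 →L[ℂ] C2) (k : Fin 3) :
    ∫ x, inner ℂ (weakPartial k u x) (M (v x)) = -∫ x, inner ℂ (u x) (M (weakPartial k v x)) := by
  have h := ((hu.hasL2Deriv k).hasWeakDeriv_inner (hv.hasL2Deriv k) M).ibp _ _ (.const (e k) 1)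
  simp only [Complex.ofReal_zero, zero_mul, integral_zero, Complex.ofReal_one, one_mul] at h
  rw [integral_add (integrable_inner_clm M _ _) (integrable_inner_clm M _ _)] at h
  linear_combination h

theorem InH1.inner_diracL (hu : InH1 u) (hv : InH2 v) :
    inner ℂ (diracL u) (diracL v) = -inner ℂ u (weakLaplacian v) := by
  have hX := integral_mul_inner_diracL (u := u) (v := v) (w := fun _ => 1) fun k l => by
    simpa only [one_mul] using integrable_inner_clm ((sigma k).comp (sigma l)) _ _
  have hY := hv.sum_integral_mul_inner_sigma_sigma (u := u) (w := fun _ => 1) fun k => by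
    simpa only [one_mul] using L2.integrable_inner u (weakPartial k (weakPartial k v))
  simp only [one_mul] at hX hY
  rw [L2.inner_def, L2.inner_def, hX, ← hY]
  simp only [← Finset.sum_neg_distrib]
  exact Finset.sum_congr rfl fun k _ => Finset.sum_congr rfl fun l _ =>
    hu.integral_inner_weakPartial (hv.inH1_weakPartial l) _ k

end Dirac

/-! ### Identities for a single Coulomb centre -/

section SingleCentre

variable {u v : HL}

/-- The Coulomb energy `∫ |x - a|⁻¹ u^* v` of the density `u^* v` and a unit charge at `a`. -/
def coulombForm (u v : HL) (a : E3) : ℂ :=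
  ∫ x, (coulomb (x - a) : ℂ) * inner ℂ (u x) (v x)

/-- `∫ (∇|x - a|⁻¹) · u^* ∇v`. -/
def gradForm (u v : HL) (a : E3) : ℂ :=
  ∑ k, ∫ x, (coulombDeriv k (x - a) : ℂ) * inner ℂ (u x) (weakPartial k v x)

/-- The `k`-th component of the vector field `F` for which `u^* σ·(G × (-i∇)) v = G · F` for all
vector fields `G`. -/
def spinOrbitDensity (k : Fin 3) (u v : HL) (x : E3) : ℂ :=
  -(Complex.I * inner ℂ (u x) (sigma (k + 2) (weakPartial (k + 1) v x))) +
    Complex.I * inner ℂ (u x) (sigma (k + 1) (weakPartial (k + 2) v x))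

/-- `∫ u^* σ·(∇|x - a|⁻¹ × (-i∇)) v`. -/
def spinOrbitForm (u v : HL) (a : E3) : ℂ :=
  ∑ k, ∫ x, (coulombDeriv k (x - a) : ℂ) * spinOrbitDensity k u v x

theorem inner_spinOrbitOp (G : E3 → E3) (u v : HL) (x : E3) :
    inner ℂ (u x) (spinOrbitOp G v x) = ∑ k, (G x k : ℂ) * spinOrbitDensity k u v x := by
  simp only [spinOrbitOp, spinOrbitDensity, map_smul, map_sub, Fin.sum_univ_three]
  simp only [Fin.isValue, zero_add, Fin.reduceAdd, inner_add_right, inner_smul_right,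
    inner_sub_right]
  ring

theorem InH2.kernelBound_diracL (hu : InH2 u) :
    KernelBound coulomb fun x => inner ℂ (diracL u x) (diracL v x) := by
  refine KernelBound.congr ?_ (inner_diracL_coe u v).symm
  exact .sum _ measurable_coulomb fun k _ => .sum _ measurable_coulomb fun l _ =>
    (hu.inH1_weakPartial k).kernelBound_inner _ _

theorem InH1.kernelBound_coulombDeriv_inner (hu : InH1 u) (hv : InH1 v) (M : C2 →L[ℂ] C2)
    (k : Fin 3) : KernelBound (coulombDeriv k) fun x => inner ℂ (u x) (M (v x)) :=
  (hu.kernelBound_sq_inner hv M).coulombDeriv k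

theorem InH1.kernelBound_spinOrbitDensity (hu : InH1 u) (hv : InH2 v) (k : Fin 3) :
    KernelBound (coulombDeriv k) (spinOrbitDensity k u v) := by
  have h := fun l M => hu.kernelBound_coulombDeriv_inner (hv.inH1_weakPartial l) M k
  refine (((h (k + 1) (sigma (k + 2))).const_mul (-Complex.I)).add
    ((h (k + 2) (sigma (k + 1))).const_mul Complex.I)).congr (ae_of_all _ fun x => ?_)
  simp only [spinOrbitDensity, neg_mul]

theorem InH1.integral_coulombDeriv_inner (hu : InH1 u) (hv : InH1 v) (M : C2 →L[ℂ] C2)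
    (k : Fin 3) (a : E3) :
    ∫ x, (coulombDeriv k (x - a) : ℂ) * inner ℂ (u x) (M (v x)) =
      -(∫ x, (coulomb (x - a) : ℂ) * inner ℂ (weakPartial k u x) (M (v x))) -
        ∫ x, (coulomb (x - a) : ℂ) * inner ℂ (u x) (M (weakPartial k v x)) := by
  have h1 := (hv.kernelBound_inner_right (weakPartial k u) M).integrable a
  have h2 := (hu.kernelBound_inner (weakPartial k v) M).integrable a
  have h := ((hu.hasL2Deriv k).hasWeakDeriv_inner (hv.hasL2Deriv k) M).integral_coulombDeriv a
    (by simp only [mul_add]; exact h1.add h2) ((hu.kernelBound_sq_inner hv M).integrable a)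
  simp only [mul_add] at h
  rw [h, integral_add h1 h2]
  ring

theorem InH1.gradForm_eq (hu : InH1 u) (hv : InH2 v) (a : E3) :
    gradForm u v a = -(∑ k, coulombForm (weakPartial k u) (weakPartial k v) a) -
      coulombForm u (weakLaplacian v) a := by
  have hL : coulombForm u (weakLaplacian v) a =
      ∑ k, coulombForm u (weakPartial k (weakPartial k v)) a :=
    hv.integral_mul_inner_weakLaplacian fun k => (hu.kernelBound_inner _ (.id ℂ C2)).integrable a
  rw [hL, gradForm, ← Finset.sum_neg_distrib, ← Finset.sum_sub_distrib]
  exact Finset.sum_congr rfl fun k _ =>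
    hu.integral_coulombDeriv_inner (hv.inH1_weakPartial k) (.id ℂ C2) k a

theorem InH1.integral_coulombDeriv_spinOrbitDensity (hu : InH1 u) (hv : InH2 v) (k : Fin 3)
    (a : E3) :
    ∫ x, (coulombDeriv k (x - a) : ℂ) * spinOrbitDensity k u v x =
      -(Complex.I * ∫ x, (coulombDeriv k (x - a) : ℂ) *
        inner ℂ (u x) (sigma (k + 2) (weakPartial (k + 1) v x))) +
      Complex.I * ∫ x, (coulombDeriv k (x - a) : ℂ) *
        inner ℂ (u x) (sigma (k + 1) (weakPartial (k + 2) v x)) := by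
  have hi := fun l M =>
    (hu.kernelBound_coulombDeriv_inner (hv.inH1_weakPartial l) M k).integrable a
  rw [← neg_mul, ← integral_const_mul, ← integral_const_mul,
    ← integral_add ((hi _ _).const_mul _) ((hi _ _).const_mul _)]
  refine integral_congr_ae (ae_of_all _ fun x => ?_)
  simp only [spinOrbitDensity]
  ring

theorem InH1.sum_integral_coulombDeriv_sigma_sigma (hu : InH1 u) (hv : InH2 v) (a : E3) :
    ∑ k, ∑ l, ∫ x, (coulombDeriv k (x - a) : ℂ) *
        inner ℂ (u x) (((sigma k).comp (sigma l)) (weakPartial l v x)) =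
      gradForm u v a - spinOrbitForm u v a := by
  rw [gradForm, spinOrbitForm, ← Finset.sum_sub_distrib]
  refine Finset.sum_congr rfl fun k _ => ?_
  rw [sum_sigma_sigma (z := fun l M => ∫ x, (coulombDeriv k (x - a) : ℂ) *
      inner ℂ (u x) (M (weakPartial l v x))) (fun l c M => integral_mul_inner_smul _ _ _ c M) k,
    hu.integral_coulombDeriv_spinOrbitDensity hv]
  simp only [ContinuousLinearMap.id_apply]
  ring

theorem InH2.coulombForm_diracL (hu : InH2 u) (hv : InH2 v) (a : E3) :
    coulombForm (diracL u) (diracL v) a =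
      -coulombForm u (weakLaplacian v) a - gradForm u v a + spinOrbitForm u v a := by
  have hD : coulombForm (diracL u) (diracL v) a = ∑ k, ∑ l, ∫ x, (coulomb (x - a) : ℂ) *
      inner ℂ (weakPartial k u x) (((sigma k).comp (sigma l)) (weakPartial l v x)) :=
    integral_mul_inner_diracL fun k l =>
      ((hu.inH1_weakPartial k).kernelBound_inner _ _).integrable a
  have hL : ∑ k, ∑ l, ∫ x, (coulomb (x - a) : ℂ) * inner ℂ (u x)
      (((sigma k).comp (sigma l)) (weakPartial k (weakPartial l v) x)) =
        coulombForm u (weakLaplacian v) a :=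
    hv.sum_integral_mul_inner_sigma_sigma fun k =>
      (hu.inH1.kernelBound_inner _ (.id ℂ C2)).integrable a
  have hibp := hu.inH1.sum_integral_coulombDeriv_sigma_sigma hv a
  simp_rw [fun k l => hu.inH1.integral_coulombDeriv_inner (hv.inH1_weakPartial l)
    ((sigma k).comp (sigma l)) k a, Finset.sum_sub_distrib, Finset.sum_neg_distrib] at hibp
  rw [← hD, hL] at hibp
  linear_combination -hibp

theorem conj_integral_ofReal_mul_inner (K : E3 → ℝ) (f g : E3 → C2) :
    conj (∫ x, (K x : ℂ) * inner ℂ (f x) (g x)) = ∫ x, (K x : ℂ) * inner ℂ (g x) (f x) := by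
  simp only [← integral_conj, map_mul, Complex.conj_ofReal, inner_conj_symm]

theorem conj_coulombForm (u v : HL) (a : E3) : conj (coulombForm v u a) = coulombForm u v a :=
  conj_integral_ofReal_mul_inner _ _ _

theorem InH2.continuous_inner_contRep (hu : InH2 u) (hv : InH2 v) :
    Continuous fun x => inner ℂ (contRep u x) (contRep v x) :=
  hu.contRep_spec.1.inner hv.contRep_spec.1

theorem InH2.bounded_inner_contRep (hu : InH2 u) (hv : InH2 v) :
    ∃ C, ∀ x, ‖(inner ℂ (contRep u x) (contRep v x) : ℂ)‖ ≤ C := by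
  obtain ⟨-, ⟨C, hC⟩, -⟩ := hu.contRep_spec
  obtain ⟨-, ⟨C', hC'⟩, -⟩ := hv.contRep_spec
  exact ⟨C * C', fun x => (norm_inner_le_norm _ _).trans
    (mul_le_mul (hC x) (hC' x) (norm_nonneg _) ((norm_nonneg _).trans (hC x)))⟩

theorem InH2.inner_contRep_ae_eq (hu : InH2 u) (hv : InH2 v) :
    (fun x => inner ℂ (u x) (v x)) =ᵐ[volume] fun x => inner ℂ (contRep u x) (contRep v x) := by
  filter_upwards [hu.contRep_spec.2.2, hv.contRep_spec.2.2] with x h1 h2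
  rw [h1, h2]

theorem InH2.gradForm_add_conj (hu : InH2 u) (hv : InH2 v) (a : E3) :
    gradForm u v a + conj (gradForm v u a) =
      pointCharge * inner ℂ (contRep u a) (contRep v a) := by
  let I := ContinuousLinearMap.id ℂ C2
  have hl := fun k => (hu.inH1_weakPartial k).kernelBound_sq_inner hv.inH1 I
  have hr := fun k => hu.inH1.kernelBound_sq_inner (hv.inH1_weakPartial k) I
  have key := sum_integral_coulombDeriv
    (fun k => (hu.inH1.hasL2Deriv k).hasWeakDeriv_inner (hv.inH1.hasL2Deriv k) I)
    (hu.continuous_inner_contRep hv) (hu.bounded_inner_contRep hv) (hu.inner_contRep_ae_eq hv) a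
    fun k => by
      simp only [mul_add]
      exact ((hl k).integrable a).add ((hr k).integrable a)
  rw [← key, gradForm, gradForm, map_sum, ← Finset.sum_add_distrib]
  refine Finset.sum_congr rfl fun k _ => ?_
  simp only [mul_add]
  rw [integral_add (((hl k).coulombDeriv k).integrable a) (((hr k).coulombDeriv k).integrable a),
    conj_integral_ofReal_mul_inner, add_comm]
  rfl

end SingleCentre

/-! ### The charge density and point charges -/

section Density

variable {q : ℕ} (u : Fin q → HL)

theorem measurable_density : Measurable (density u) :=
  Finset.measurable_fun_sum _ fun n _ => (Lp.stronglyMeasurable (u n)).measurable.norm.pow_const 2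

theorem density_nonneg (x : E3) : 0 ≤ density u x := Finset.sum_nonneg fun _ _ => sq_nonneg _

theorem integrable_density : Integrable (density u) :=
  integrable_finsetSum _ fun n _ => integrable_norm_sq (u n)

/-- The electronic charge distribution `ρ_γ dx`. -/
def rhoMeasure : Measure E3 := volume.withDensity fun x => ENNReal.ofReal (density u x)

instance : IsFiniteMeasure (rhoMeasure u) :=
  isFiniteMeasure_withDensity_ofReal (integrable_density u).2

theorem meanField_eq_pairPot (μ : Measure E3) :
    meanField μ u = pairPot coulomb μ (rhoMeasure u) := by
  funext x
  rw [meanField, pairPot, nuclearV, directW, rhoMeasure,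
    integral_withDensity_eq_integral_toReal_smul (measurable_density u).ennreal_ofReal
      (ae_of_all _ fun _ => ENNReal.ofReal_lt_top)]
  simp only [ENNReal.toReal_ofReal (density_nonneg u _), smul_eq_mul]

end Density

theorem coulomb_sub_comm (x y : E3) : coulomb (x - y) = coulomb (y - x) := by
  rw [coulomb, coulomb, norm_sub_rev]

theorem coulomb_sub_eq_pairPot (x : E3) :
    (fun y => coulomb (x - y)) = pairPot coulomb 0 (Measure.dirac x) := by
  funext y
  simp [pairPot, coulomb_sub_comm x]

theorem pairIntegral_zero_dirac (x : E3) (f : E3 → ℂ) :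
    pairIntegral 0 (Measure.dirac x) f = f x := by
  simp [pairIntegral]

/-! ### Bounded functions of the centre -/

/-- `f` is bounded and strongly measurable, hence integrable against every finite measure and a
multiplier of every `L¹` space. -/
structure IsBoundedMeasurable (f : E3 → ℂ) : Prop where
  stronglyMeasurable : StronglyMeasurable f
  bounded : ∃ C, ∀ a, ‖f a‖ ≤ C

namespace IsBoundedMeasurable

variable {f g : E3 → ℂ}

theorem add (hf : IsBoundedMeasurable f) (hg : IsBoundedMeasurable g) :
    IsBoundedMeasurable fun a => f a + g a := by
  obtain ⟨C, hC⟩ := hf.bounded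
  obtain ⟨C', hC'⟩ := hg.bounded
  exact ⟨hf.stronglyMeasurable.add hg.stronglyMeasurable, C + C', fun a =>
    norm_add_le_of_le (hC a) (hC' a)⟩

theorem sum {ι : Type*} (s : Finset ι) {f : ι → E3 → ℂ} (hf : ∀ i, IsBoundedMeasurable (f i)) :
    IsBoundedMeasurable fun a => ∑ i ∈ s, f i a := by
  choose C hC using fun i => (hf i).bounded
  exact ⟨Finset.stronglyMeasurable_fun_sum _ fun i _ => (hf i).stronglyMeasurable, ∑ i ∈ s, C i,
    fun a => norm_sum_le_of_le _ fun i _ => hC i a⟩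

theorem star (hf : IsBoundedMeasurable f) : IsBoundedMeasurable fun a => conj (f a) :=
  ⟨Complex.continuous_conj.comp_stronglyMeasurable hf.stronglyMeasurable, by
    simpa only [RCLike.norm_conj] using hf.bounded⟩

variable {ν : Measure E3}

theorem integrable_mul (hf : IsBoundedMeasurable f) {w : E3 → ℂ} (hw : Integrable w ν) :
    Integrable (fun a => w a * f a) ν := by
  obtain ⟨C, hC⟩ := hf.bounded
  exact hw.mul_bdd hf.stronglyMeasurable.aestronglyMeasurable (ae_of_all _ hC)

theorem integrable [IsFiniteMeasure ν] (hf : IsBoundedMeasurable f) : Integrable f ν := by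
  simpa only [one_mul] using hf.integrable_mul (integrable_const (1 : ℂ))

theorem pairIntegral_add (hf : IsBoundedMeasurable f) (hg : IsBoundedMeasurable g)
    (ν₁ ν₂ : Measure E3) [IsFiniteMeasure ν₁] [IsFiniteMeasure ν₂] :
    pairIntegral ν₁ ν₂ (fun a => f a + g a) = pairIntegral ν₁ ν₂ f + pairIntegral ν₁ ν₂ g := by
  simp only [pairIntegral]
  rw [integral_add hf.integrable hg.integrable, integral_add hf.integrable hg.integrable]
  ring

end IsBoundedMeasurable

theorem KernelBound.isBoundedMeasurable {K : E3 → ℝ} {F : E3 → ℂ} (h : KernelBound K F) :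
    IsBoundedMeasurable fun a => ∫ x, (K (x - a) : ℂ) * F x := by
  obtain ⟨C, hC⟩ := h.exists_norm_integral_le
  refine ⟨?_, C, fun a => (norm_integral_le_integral_norm _).trans (hC a)⟩
  have hF := h.aestronglyMeasurable
  have hmk : ∀ a, ∫ x, (K (x - a) : ℂ) * F x = ∫ x, (K (x - a) : ℂ) * hF.mk F x := fun a => by
    refine integral_congr_ae ?_
    filter_upwards [hF.ae_eq_mk] with x hx
    rw [hx]
  simp only [hmk]
  exact StronglyMeasurable.integral_prod_right' (f := fun p : E3 × E3 =>
    (K (p.2 - p.1) : ℂ) * hF.mk F p.2) ((Complex.measurable_ofReal.comp (h.measurable.comp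
      (measurable_snd.sub measurable_fst))).stronglyMeasurable.mul
        (hF.stronglyMeasurable_mk.comp_measurable measurable_snd))

section Forms

variable {u v : HL}

theorem InH1.isBoundedMeasurable_coulombForm (hu : InH1 u) (v : HL) :
    IsBoundedMeasurable (coulombForm u v) :=
  (hu.kernelBound_inner v (.id ℂ C2)).isBoundedMeasurable

theorem InH2.isBoundedMeasurable_coulombForm_diracL (hu : InH2 u) (v : HL) :
    IsBoundedMeasurable (coulombForm (diracL u) (diracL v)) :=
  hu.kernelBound_diracL.isBoundedMeasurable

theorem InH1.isBoundedMeasurable_gradForm (hu : InH1 u) (hv : InH2 v) :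
    IsBoundedMeasurable (gradForm u v) :=
  .sum _ fun k => (hu.kernelBound_coulombDeriv_inner (hv.inH1_weakPartial k) (.id ℂ C2)
    k).isBoundedMeasurable

theorem InH1.isBoundedMeasurable_spinOrbitForm (hu : InH1 u) (hv : InH2 v) :
    IsBoundedMeasurable (spinOrbitForm u v) :=
  .sum _ fun k => (hu.kernelBound_spinOrbitDensity hv k).isBoundedMeasurable

theorem InH2.isBoundedMeasurable_inner_contRep (hu : InH2 u) (hv : InH2 v) :
    IsBoundedMeasurable fun a => inner ℂ (contRep u a) (contRep v a) :=
  ⟨(hu.continuous_inner_contRep hv).stronglyMeasurable, hu.bounded_inner_contRep hv⟩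

/-! ### Potentials integrated against products of spinors -/

theorem integral_inner_coulomb_smul (u v : HL) (x : E3) :
    ∫ y, inner ℂ (u y) ((coulomb (x - y) : ℂ) • v y) = coulombForm u v x := by
  simp only [coulombForm, inner_smul_right, coulomb_sub_comm x]

section Potential

variable (ν₁ ν₂ : Measure E3) [IsFiniteMeasure ν₁] [IsFiniteMeasure ν₂]

theorem inner_spinOrbitOp_weakGrad_coe (u v : HL) :
    (fun x => inner ℂ (u x) (spinOrbitOp (weakGrad (pairPot coulomb ν₁ ν₂)) v x)) =ᵐ[volume]
      fun x => ∑ k, (pairPot (coulombDeriv k) ν₁ ν₂ x : ℂ) * spinOrbitDensity k u v x := by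
  have hG := isWeakGradient_pairPot ν₁ ν₂
  filter_upwards [hG.weakGrad.ae_eq hG] with x hx
  simp only [inner_spinOrbitOp, hx, pairGrad_apply]

theorem InH1.integrable_inner_spinOrbitOp (hu : InH1 u) (hv : InH2 v) :
    Integrable fun x => inner ℂ (u x) (spinOrbitOp (weakGrad (pairPot coulomb ν₁ ν₂)) v x) :=
  (integrable_finsetSum _ fun k _ =>
    (hu.kernelBound_spinOrbitDensity hv k).integrable_pairPot ν₁ ν₂).congr
      (inner_spinOrbitOp_weakGrad_coe ν₁ ν₂ u v).symm

theorem InH1.integral_inner_spinOrbitOp (hu : InH1 u) (hv : InH2 v) :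
    ∫ x, inner ℂ (u x) (spinOrbitOp (weakGrad (pairPot coulomb ν₁ ν₂)) v x) =
      pairIntegral ν₁ ν₂ (spinOrbitForm u v) := by
  have hk := hu.kernelBound_spinOrbitDensity hv
  rw [integral_congr_ae (inner_spinOrbitOp_weakGrad_coe ν₁ ν₂ u v),
    integral_finsetSum _ fun k _ => (hk k).integrable_pairPot ν₁ ν₂]
  simp_rw [fun k => (hk k).integral_pairPot ν₁ ν₂]
  simp only [pairIntegral, spinOrbitForm]
  rw [integral_finsetSum _ fun k _ => (hk k).isBoundedMeasurable.integrable,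
    integral_finsetSum _ fun k _ => (hk k).isBoundedMeasurable.integrable,
    Finset.sum_add_distrib, Finset.sum_neg_distrib]

end Potential

theorem InH1.integral_inner_spinOrbitOp_coulomb (hu : InH1 u) (hv : InH2 v) (x : E3) :
    ∫ y, inner ℂ (u y) (spinOrbitOp (weakGrad fun y => coulomb (x - y)) v y) =
      spinOrbitForm u v x := by
  rw [coulomb_sub_eq_pairPot, hu.integral_inner_spinOrbitOp _ _ hv, pairIntegral_zero_dirac]

end Forms

theorem signedIntegral_distribLaplacian_coulomb (x : E3) {f : E3 → ℂ} (hf : Continuous f)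
    (hb : ∃ C, ∀ x, ‖f x‖ ≤ C) :
    signedIntegral (distribLaplacian fun y => coulomb (x - y)) f = -(pointCharge * f x) := by
  rw [coulomb_sub_eq_pairPot, signedIntegral_distribLaplacian_pairPot _ _ hf hb,
    pairIntegral_zero_dirac]

/-! ### The mean-field interaction -/

section Interaction

variable (μ : Measure E3) {q : ℕ} (u : Fin q → HL)

/-- Direct minus exchange interaction of the potentials `h m n` generated by pairs of orbitals. -/
def interaction (h : Fin q → Fin q → E3 → ℂ) : ℂ :=
  (∑ n, pairIntegral μ (rhoMeasure u) (h n n)) -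
    ∑ m, ∑ n, ∫ x, inner ℂ (u n x) (u m x) * h m n x

theorem interaction_add [IsFiniteMeasure μ] {h h' : Fin q → Fin q → E3 → ℂ}
    (hh : ∀ m n, IsBoundedMeasurable (h m n)) (hh' : ∀ m n, IsBoundedMeasurable (h' m n)) :
    interaction μ u (fun m n a => h m n a + h' m n a) =
      interaction μ u h + interaction μ u h' := by
  have hi := fun m n => L2.integrable_inner (𝕜 := ℂ) (u n) (u m)
  simp only [interaction, mul_add]
  simp_rw [fun n => (hh n n).pairIntegral_add (hh' n n) μ (rhoMeasure u), fun m n =>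
    integral_add ((hh m n).integrable_mul (hi m n)) ((hh' m n).integrable_mul (hi m n)),
    Finset.sum_add_distrib]
  ring

theorem interaction_const_mul (c : ℂ) (h : Fin q → Fin q → E3 → ℂ) :
    interaction μ u (fun m n a => c * h m n a) = c * interaction μ u h := by
  simp only [interaction, pairIntegral, mul_left_comm _ c, integral_const_mul, mul_sub,
    Finset.mul_sum, mul_add, mul_neg]

theorem interaction_conj (h : Fin q → Fin q → E3 → ℂ) :
    interaction μ u (fun m n a => conj (h n m a)) = conj (interaction μ u h) := by
  simp only [interaction, pairIntegral, map_sub, map_sum, map_add, map_neg, ← integral_conj,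
    map_mul, inner_conj_symm]
  rw [Finset.sum_comm]

variable {u} [IsFiniteMeasure μ]

theorem E2_eq_interaction (hu : ∀ n, InH2 (u n)) {c : ℝ} (hc : c ≠ 0) (ε : Fin q → ℝ) :
    4 * (c : ℂ) ^ 2 * E2 c μ u ε =
      -(∑ n, (ε n : ℂ) * inner ℂ (diracL (u n)) (diracL (u n))) +
        interaction μ u fun m n => coulombForm (diracL (u m)) (diracL (u n)) := by
  have hdirect : ∀ n, ∫ x, inner ℂ (diracL (u n) x) ((meanField μ u x : ℂ) • diracL (u n) x) =
      pairIntegral μ (rhoMeasure u) (coulombForm (diracL (u n)) (diracL (u n))) := fun n => by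
    simp only [inner_smul_right, meanField_eq_pairPot]
    exact (hu n).kernelBound_diracL.integral_pairPot _ _
  have hc' : (c : ℂ) ≠ 0 := Complex.ofReal_ne_zero.2 hc
  simp only [E2, hdirect, integral_inner_coulomb_smul, interaction]
  field_simp
  ring

theorem Eso_eq_interaction (hu : ∀ n, InH2 (u n)) :
    Eso μ u = interaction μ u fun m n => spinOrbitForm (u m) (u n) := by
  simp only [Eso, interaction, meanField_eq_pairPot]
  simp_rw [fun n => (hu n).inH1.integral_inner_spinOrbitOp μ (rhoMeasure u) (hu n),
    fun m n x => (hu m).inH1.integral_inner_spinOrbitOp_coulomb (hu n) x]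

theorem ED_eq_interaction (hu : ∀ n, InH2 (u n)) :
    ED μ u = -(pointCharge / 2 : ℂ) *
      interaction μ u fun m n a => inner ℂ (contRep (u m) a) (contRep (u n) a) := by
  have hc := fun m n => (hu m).continuous_inner_contRep (hu n)
  have hb := fun m n => (hu m).bounded_inner_contRep (hu n)
  simp only [ED, interaction, meanField_eq_pairPot]
  simp_rw [fun m n x => signedIntegral_distribLaplacian_coulomb x (hc m n) (hb m n),
    fun n => signedIntegral_distribLaplacian_pairPot μ (rhoMeasure u) (hc n n) (hb n n), mul_neg,
    integral_neg, mul_left_comm _ (pointCharge : ℂ), integral_const_mul, Finset.sum_neg_distrib,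
    ← Finset.mul_sum]
  ring

end Interaction

/-! ### The Hartree–Fock equations -/

section Equations

variable {μ : Measure E3} {q : ℕ} {u : Fin q → HL}

/-- `ψ` solves the Hartree–Fock equation `(-Δ/2 - V + W_{1,γ} - W_{2,γ}) ψ = E ψ` for the density
matrix `γ` of the orbitals `u`, which need neither be orthonormal nor contain `ψ`. -/
def IsHFEigenfunction (μ : Measure E3) (u : Fin q → HL) (ψ : HL) (E : ℝ) : Prop :=
  ∀ᵐ x : E3, -(1 / 2 : ℂ) • weakLaplacian ψ x + (meanField μ u x : ℂ) • ψ x -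
    exchangeW u ψ x = (E : ℂ) • ψ x

theorem inner_exchangeW (hu : ∀ m, InH1 (u m)) (ψ : HL) (x : E3) (w : C2) :
    inner ℂ (exchangeW u ψ x) w =
      ∑ m, (∫ y, inner ℂ (ψ y) (u m y) * (coulomb (y - x) : ℂ)) * inner ℂ (u m x) w := by
  have hi : ∀ m, Integrable fun y => (coulomb (y - x) : ℂ) * inner ℂ (u m y) (ψ y) :=
    fun m => ((hu m).kernelBound_inner ψ (.id ℂ C2)).integrable x
  have hW : exchangeW u ψ x =
      ∑ m, (∫ y, (coulomb (y - x) : ℂ) * inner ℂ (u m y) (ψ y)) • u m x := by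
    simp only [exchangeW, gammaKernel, Finset.smul_sum, smul_smul, coulomb_sub_comm x]
    rw [integral_finsetSum _ fun m _ => (hi m).smul_const _]
    simp only [integral_smul_const]
  rw [hW, sum_inner]
  refine Finset.sum_congr rfl fun m _ => ?_
  rw [inner_smul_left, conj_integral_ofReal_mul_inner]
  simp only [mul_comm]

theorem IsHFEigenfunction.inner_coe {ψ : HL} {E : ℝ} (h : IsHFEigenfunction μ u ψ E)
    (hu : ∀ m, InH1 (u m)) (w : HL) :
    (fun x => (E : ℂ) * inner ℂ (ψ x) (w x)) =ᵐ[volume] fun x =>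
      -(1 / 2 : ℂ) * inner ℂ (weakLaplacian ψ x) (w x) +
        (pairPot coulomb μ (rhoMeasure u) x : ℂ) * inner ℂ (ψ x) (w x) -
        ∑ m, (∫ y, inner ℂ (ψ y) (u m y) * (coulomb (x - y) : ℂ)) * inner ℂ (u m x) (w x) := by
  filter_upwards [h] with x hx
  have := congrArg (fun z => inner ℂ z (w x)) hx
  simp only [inner_sub_left, inner_add_left, inner_smul_left, inner_exchangeW hu,
    Complex.conj_ofReal, meanField_eq_pairPot] at this
  rw [← this, map_neg, map_div₀, map_one, Complex.conj_ofNat]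
  simp only [coulomb_sub_comm x]

theorem IsHFEigenfunction.inner_eq [IsFiniteMeasure μ] {ψ : HL} {E : ℝ}
    (h : IsHFEigenfunction μ u ψ E) (hu : ∀ m, InH1 (u m)) (hψ : InH1 ψ) (w : HL) :
    (E : ℂ) * inner ℂ ψ w = -(1 / 2 : ℂ) * inner ℂ (weakLaplacian ψ) w +
      pairIntegral μ (rhoMeasure u) (coulombForm ψ w) -
      ∑ m, ∫ x, inner ℂ (ψ x) (u m x) * coulombForm (u m) w x := by
  have hψw := hψ.kernelBound_inner w (.id ℂ C2)
  have hK := fun m => (hu m).kernelBound_inner w (.id ℂ C2)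
  have hkinetic := (L2.integrable_inner (𝕜 := ℂ) (weakLaplacian ψ) w).const_mul (-(1 / 2 : ℂ))
  have hdirect := hψw.integrable_pairPot μ (rhoMeasure u)
  have hexchange := fun m => (hK m).integrable_convolution (L2.integrable_inner (𝕜 := ℂ) ψ (u m))
  simp only [ContinuousLinearMap.id_apply] at hdirect hexchange
  rw [L2.inner_def, L2.inner_def, ← integral_const_mul, integral_congr_ae (h.inner_coe hu w),
    integral_sub (hkinetic.fun_add hdirect) (integrable_finsetSum _ fun m _ => hexchange m),
    integral_add hkinetic hdirect, integral_const_mul,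
    integral_finsetSum _ fun m _ => hexchange m]
  exact congrArg₂ _ (congrArg _ (hψw.integral_pairPot μ (rhoMeasure u)))
    (Finset.sum_congr rfl fun m _ => (hK m).integral_convolution (L2.integrable_inner ψ (u m)))

variable [IsFiniteMeasure μ] {ε : Fin q → ℝ}

theorem sum_eigenvalue_inner_weakLaplacian (hu : ∀ n, InH2 (u n))
    (h : ∀ n, IsHFEigenfunction μ u (u n) (ε n)) :
    ∑ n, (ε n : ℂ) * inner ℂ (u n) (weakLaplacian (u n)) =
      Emv u + interaction μ u fun m n => coulombForm (u m) (weakLaplacian (u n)) := by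
  simp_rw [fun n => (h n).inner_eq (fun m => (hu m).inH1) (hu n).inH1 (weakLaplacian (u n)),
    Finset.sum_sub_distrib, Finset.sum_add_distrib]
  rw [Emv, interaction, Finset.mul_sum, Finset.sum_comm]
  simp only [inner_neg_neg]
  ring

/-! ### The decomposition of the relativistic correction -/

theorem conj_Emv (u : Fin q → HL) : conj (Emv u) = Emv u := by
  simp only [Emv, map_mul, map_sum, inner_conj_symm, map_neg, map_div₀, map_one,
    Complex.conj_ofNat]

theorem conj_inner_weakLaplacian {v : HL} (hv : InH2 v) :
    conj (inner ℂ v (weakLaplacian v)) = inner ℂ v (weakLaplacian v) := by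
  rw [← neg_neg (inner ℂ v (weakLaplacian v)), ← hv.inH1.inner_diracL hv, map_neg,
    inner_conj_symm]

theorem conj_interaction_weakLaplacian (hu : ∀ n, InH2 (u n))
    (h : ∀ n, IsHFEigenfunction μ u (u n) (ε n)) :
    conj (interaction μ u fun m n => coulombForm (u m) (weakLaplacian (u n))) =
      interaction μ u fun m n => coulombForm (u m) (weakLaplacian (u n)) := by
  rw [eq_sub_iff_add_eq'.2 (sum_eigenvalue_inner_weakLaplacian hu h).symm, map_sub, conj_Emv,
    map_sum]
  simp only [map_mul, Complex.conj_ofReal, conj_inner_weakLaplacian (hu _)]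

theorem interaction_weakPartial_add_weakLaplacian (μ : Measure E3) [IsFiniteMeasure μ]
    (hu : ∀ n, InH2 (u n)) :
    interaction μ u (fun m n a =>
        ∑ k, coulombForm (weakPartial k (u m)) (weakPartial k (u n)) a) +
      interaction μ u (fun m n => coulombForm (u m) (weakLaplacian (u n))) =
        -interaction μ u fun m n => gradForm (u m) (u n) := by
  rw [← interaction_add μ u
    (fun m n => .sum _ fun k => ((hu m).inH1_weakPartial k).isBoundedMeasurable_coulombForm _)
    fun m n => (hu m).inH1.isBoundedMeasurable_coulombForm _, ← neg_one_mul,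
    ← interaction_const_mul]
  congr! 4 with m n a
  rw [(hu m).inH1.gradForm_eq (hu n)]
  ring

theorem conj_interaction_weakPartial (μ : Measure E3) (u : Fin q → HL) :
    conj (interaction μ u fun m n a =>
        ∑ k, coulombForm (weakPartial k (u m)) (weakPartial k (u n)) a) =
      interaction μ u fun m n a =>
        ∑ k, coulombForm (weakPartial k (u m)) (weakPartial k (u n)) a := by
  simp only [← interaction_conj, map_sum, conj_coulombForm]

theorem conj_interaction_gradForm (hu : ∀ n, InH2 (u n))
    (h : ∀ n, IsHFEigenfunction μ u (u n) (ε n)) :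
    conj (interaction μ u fun m n => gradForm (u m) (u n)) =
      interaction μ u fun m n => gradForm (u m) (u n) := by
  rw [← neg_inj, ← map_neg, ← interaction_weakPartial_add_weakLaplacian μ hu, map_add,
    conj_interaction_weakPartial, conj_interaction_weakLaplacian hu h]

theorem interaction_gradForm_add_conj (μ : Measure E3) [IsFiniteMeasure μ]
    (hu : ∀ n, InH2 (u n)) :
    interaction μ u (fun m n => gradForm (u m) (u n)) +
      conj (interaction μ u fun m n => gradForm (u m) (u n)) =
        pointCharge * interaction μ u fun m n a => inner ℂ (contRep (u m) a) (contRep (u n) a) := by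
  have hG := fun m n => (hu m).inH1.isBoundedMeasurable_gradForm (hu n)
  rw [← interaction_conj, ← interaction_add μ u hG fun m n => (hG n m).star,
    ← interaction_const_mul]
  congr! 4 with m n a
  exact (hu m).gradForm_add_conj (hu n) a

theorem interaction_gradForm (hu : ∀ n, InH2 (u n))
    (h : ∀ n, IsHFEigenfunction μ u (u n) (ε n)) :
    interaction μ u (fun m n => gradForm (u m) (u n)) = -ED μ u := by
  have hre := interaction_gradForm_add_conj μ hu
  rw [conj_interaction_gradForm hu h] at hre
  rw [ED_eq_interaction μ hu]
  linear_combination (1 / 2 : ℂ) * hre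

theorem interaction_coulombForm_diracL (μ : Measure E3) [IsFiniteMeasure μ]
    (hu : ∀ n, InH2 (u n)) :
    interaction μ u (fun m n => coulombForm (diracL (u m)) (diracL (u n))) +
        interaction μ u (fun m n => coulombForm (u m) (weakLaplacian (u n))) +
        interaction μ u (fun m n => gradForm (u m) (u n)) = Eso μ u := by
  have hD := fun m n => (hu m).isBoundedMeasurable_coulombForm_diracL (u n)
  have hL := fun m n => (hu m).inH1.isBoundedMeasurable_coulombForm (weakLaplacian (u n))
  rw [Eso_eq_interaction μ hu, ← interaction_add μ u hD hL,
    ← interaction_add μ u (fun m n => (hD m n).add (hL m n))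
      fun m n => (hu m).inH1.isBoundedMeasurable_gradForm (hu n)]
  congr! 4 with m n a
  rw [(hu m).coulombForm_diracL (hu n)]
  ring

theorem E2_eq_Emv_add_ED_add_Eso (hu : ∀ n, InH2 (u n))
    (h : ∀ n, IsHFEigenfunction μ u (u n) (ε n)) {c : ℝ} (hc : c ≠ 0) :
    4 * (c : ℂ) ^ 2 * E2 c μ u ε = Emv u + ED μ u + Eso μ u := by
  have hkinetic : ∑ n, (ε n : ℂ) * inner ℂ (diracL (u n)) (diracL (u n)) =
      -∑ n, (ε n : ℂ) * inner ℂ (u n) (weakLaplacian (u n)) := by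
    simp_rw [fun n => (hu n).inH1.inner_diracL (hu n), mul_neg, Finset.sum_neg_distrib]
  rw [E2_eq_interaction μ hu hc, hkinetic, neg_neg, sum_eigenvalue_inner_weakLaplacian hu h]
  linear_combination interaction_coulombForm_diracL μ hu - interaction_gradForm hu h

theorem wellDefined_of_inH2 (μ : Measure E3) [IsFiniteMeasure μ] (hu : ∀ n, InH2 (u n)) :
    WellDefined μ u where
  weakPartial_eq n k := (hu n).inH1.weakPartial_spec k
  weakLaplacian_eq n := (hu n).weakLaplacian_spec
  contRep_spec n := ⟨(hu n).contRep_spec.1, (hu n).contRep_spec.2.2⟩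
  laplacian_meanField := by
    rw [meanField_eq_pairPot]
    exact isDistribLaplacian_pairPot _ _
  laplacian_coulomb x := by
    rw [coulomb_sub_eq_pairPot]
    exact isDistribLaplacian_pairPot _ _
  gradient_meanField := by
    rw [meanField_eq_pairPot]
    exact (isWeakGradient_pairPot _ _).weakGrad
  gradient_coulomb x := by
    rw [coulomb_sub_eq_pairPot]
    exact (isWeakGradient_pairPot _ _).weakGrad
  integrable_direct n := by
    simp only [inner_smul_right, meanField_eq_pairPot]
    exact (hu n).kernelBound_diracL.integrable_pairPot _ _
  integrable_exchange_inner m n x := by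
    simp only [inner_smul_right, coulomb_sub_comm x]
    exact (hu m).kernelBound_diracL.integrable x
  integrable_exchange m n := by
    simp only [integral_inner_coulomb_smul]
    exact ((hu m).isBoundedMeasurable_coulombForm_diracL _).integrable_mul
      (L2.integrable_inner _ _)
  integrable_darwin n := signedIntegrable_of_continuous_bounded
    ((hu n).continuous_inner_contRep (hu n)) ((hu n).bounded_inner_contRep (hu n)) _
  integrable_darwin_exchange_inner m n x := signedIntegrable_of_continuous_bounded
    ((hu m).continuous_inner_contRep (hu n)) ((hu m).bounded_inner_contRep (hu n)) _
  integrable_darwin_exchange m n := by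
    simp only [signedIntegral_distribLaplacian_coulomb _ ((hu m).continuous_inner_contRep (hu n))
      ((hu m).bounded_inner_contRep (hu n)), mul_neg, mul_left_comm _ (pointCharge : ℂ)]
    exact (((hu m).isBoundedMeasurable_inner_contRep (hu n)).integrable_mul
      (L2.integrable_inner _ _)).const_mul _ |>.neg
  integrable_spinOrbit n := by
    rw [meanField_eq_pairPot]
    exact (hu n).inH1.integrable_inner_spinOrbitOp _ _ (hu n)
  integrable_spinOrbit_exchange_inner m n x := by
    rw [coulomb_sub_eq_pairPot]
    exact (hu m).inH1.integrable_inner_spinOrbitOp _ _ (hu n)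
  integrable_spinOrbit_exchange m n := by
    simp only [(hu m).inH1.integral_inner_spinOrbitOp_coulomb (hu n)]
    exact ((hu m).inH1.isBoundedMeasurable_spinOrbitForm (hu n)).integrable_mul
      (L2.integrable_inner _ _)

end Equations

end HartreeFock

end

theorem mainTheorem4_general (μ : MeasureTheory.Measure HartreeFock.E3)
    [MeasureTheory.IsFiniteMeasure μ] {c : ℝ} (hc : c ≠ 0) {q : ℕ} {u : Fin q → HartreeFock.HL}
    {ε : Fin q → ℝ} (hu : ∀ n, HartreeFock.InH2 (u n))
    (h : ∀ n, HartreeFock.IsHFEigenfunction μ u (u n) (ε n)) :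
    HartreeFock.WellDefined μ u ∧
      4 * (c : ℂ) ^ 2 * HartreeFock.E2 c μ u ε =
        HartreeFock.Emv u + HartreeFock.ED μ u + HartreeFock.Eso μ u :=
  ⟨HartreeFock.wellDefined_of_inH2 μ hu, HartreeFock.E2_eq_Emv_add_ED_add_Eso hu h hc⟩

theorem mainTheorem4 (μ : MeasureTheory.Measure HartreeFock.E3) [MeasureTheory.IsFiniteMeasure μ]
    (c : ℝ) (hc : 0 < c) (q : ℕ) (u : Fin q → HartreeFock.HL) (ε : Fin q → ℝ)
    (hu : HartreeFock.IsHFState μ u ε) :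
    HartreeFock.WellDefined μ u ∧
      4 * (c : ℂ) ^ 2 * HartreeFock.E2 c μ u ε =
        HartreeFock.Emv u + HartreeFock.ED μ u + HartreeFock.Eso μ u :=
  mainTheorem4_general μ hc.ne' hu.mem_domain hu.eigen
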